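/- **Redistricting.** An instance consists of $n$ voters with locations $\mathsf{loc}\colon[n]\to\mathbb{Q}^2$ and preferences $\mathsf{pref}\colon[n]\to\{0,1\}$, a number $k$ of districts and a number $m$. For rationals $\gamma\in(0,1)$ and $d>0$, the instance is *satisfiable* if there is a partition $D_1\sqcup\cdots\sqcup D_k=[n]$ such that - (F1) $(1-\gamma)\frac nk\le |D_l|\le(1+\gamma)\frac nk$ for every $l$; - (F2) $\operatorname{hull}(\mathsf{loc}(D_l))\cap\operatorname{hull}(\mathsf{loc}(D_{l'}))=\emptyset$ for all $l\ne l'$; - (F3) $\|\mathsf{loc}(i)-\mathsf{loc}(j)\|_2\le d$ whenever $i,j$ lie in the same $D_l$; - (F4) $|D_l\cap\mathsf{pref}^{-1}(1)|>\frac12|D_l|$ for at least $m$ indices $l$. **Planar 3-SAT.** Every clause has three literals over three distinct variables, and the bipartite graph with one vertex per variable, one vertex per clause, and an edge whenever the variable occurs in the clause, is planar. **The construction.** Given a planar 3-SAT instance, take a planar embedding of this graph with integer vertex coordinates and a radius $\delta>0$ such that, in the disk of radius $\delta$ around each clause vertex, the three incident edges are straight segments leaving the vertex at $0,\frac{2\pi}3,\frac{4\pi}3$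 radians, and no other edge enters the disk. Take rationals $\eta,\varepsilon>0$ with $200\eta<\delta$ and $200\varepsilon<\eta$. Place towns at rational points as follows. - At each clause vertex $v$, a big clause town at $v$ and a small clause town at $v+(\varepsilon,0)$. - About each clause vertex, six clause-adjacent towns, at distances in $[0.99\eta,\eta]$ from $v$ and at angles within one degree of $\frac{2\pi j}{18}$, $j\in\{1,5,7,11,13,17\}$, so that two of them lie on either side of each incident edge. - For each variable $x$ that occurs in some clause, edge towns in the set $C_x$ of points between $\eta$ and $\frac32\eta$ away from the edges incident to $x$. They form chains that connect, in a cyclic order of the edges incident to $x$, the clockwise clause-adjacent town of each edge (clockwise as seen from the clause vertex) to the counterclockwise clause-adjacent town of the next edge. Consecutive towns of a chain (including its two clause-adjacent end towns) are between $0.99\eta$ and $\eta$ apart, and every town other than its two chain neighbours is more than $\eta+\varepsilon$ away from an edge town. The number of edge towns in a chain is even if $x$ has equal signs in the two clauses that it connects, and odd if the signs are opposite. Multiply all town coordinates by $d/(\eta+\varepsilon)$. Let $L>1/\gamma^2$ be a multiple of $4$ and place voters at the towns: - big clause town: $L$ voters with preference $1$; - small clause town: $\lfloor\frac{2\gamma}3L\rfloor$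 voters with preference $1$; - clause-adjacent town: $\frac L4$ voters with preference $1$ and $\frac L4+\lfloor\frac\gamma6L\rfloor$ with preference $0$; - edge town: $\frac L4-\lfloor\frac\gamma4L\rfloor$ voters with preference $1$ and $\frac L4+\lfloor\frac\gamma4L\rfloor$ with preference $0$. Let $k$ be the number of clauses plus half the number of clause-adjacent and edge towns, and let $m$ be twice the number of clauses. **Lemma.** Let $\gamma\in(0,\frac13]$ and $d>0$ be rational. For every planar 3-SAT instance and every instance of fair $(\gamma,d)$-legal redistricting obtained from it by this construction, the redistricting instance is satisfiable (there is a partition with (F1)–(F4)) if and only if the 3-SAT instance is satisfiable. -/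

import Mathlib

open scoped Real

/-! ### Fair legal redistricting -/

/-- The Euclidean plane. -/
abbrev Plane : Type := EuclideanSpace ℝ (Fin 2)

/-- The point of the plane with the given rational coordinates. -/
noncomputable def toPlane (p : ℚ × ℚ) : Plane := !₂[(p.1 : ℝ), (p.2 : ℝ)]

/-- The point at distance `r` from the origin at angle `θ` radians. -/
noncomputable def polarPoint (r θ : ℝ) : Plane := !₂[r * Real.cos θ, r * Real.sin θ]

/-- An input `(n, k, loc, m, pref)`: `n` voters with locations and preferences, a number `k` of
districts and a required number `m` of districts with majority preference `1`. -/
structure RedistrictingInstance where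
  n : ℕ
  k : ℕ
  loc : Fin n → ℚ × ℚ
  m : ℕ
  pref : Fin n → Fin 2

namespace RedistrictingInstance

variable (I : RedistrictingInstance)

/-- `D` is a partition of the voters into `k` labelled parts. -/
def IsPartition (D : Fin I.k → Finset (Fin I.n)) : Prop :=
  (∀ l l', l ≠ l' → Disjoint (D l) (D l')) ∧ ∀ i, ∃ l, i ∈ D l

/-- (F1): all districts have about the same number of voters. -/
def F1 (γ : ℚ) (D : Fin I.k → Finset (Fin I.n)) : Prop :=
  ∀ l, (1 - γ) * ((I.n : ℚ) / (I.k : ℚ)) ≤ ((D l).card : ℚ) ∧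
    ((D l).card : ℚ) ≤ (1 + γ) * ((I.n : ℚ) / (I.k : ℚ))

/-- The convex hull of the locations of a set of voters. -/
def hull (S : Finset (Fin I.n)) : Set Plane :=
  convexHull ℝ ((fun i => toPlane (I.loc i)) '' (S : Set (Fin I.n)))

/-- (F2): the convex hulls of distinct districts are disjoint. -/
def F2 (D : Fin I.k → Finset (Fin I.n)) : Prop :=
  ∀ l l', l ≠ l' → I.hull (D l) ∩ I.hull (D l') = ∅

/-- (F3): any two voters of the same district are at Euclidean distance at most `d`. -/
def F3 (d : ℚ) (D : Fin I.k → Finset (Fin I.n)) : Prop :=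
  ∀ l, ∀ i ∈ D l, ∀ j ∈ D l, ‖toPlane (I.loc i) - toPlane (I.loc j)‖ ≤ (d : ℝ)

/-- (F4): in at least `m` districts, strictly more than half of the voters have preference `1`. -/
def F4 (D : Fin I.k → Finset (Fin I.n)) : Prop :=
  I.m ≤ (Finset.univ.filter fun l : Fin I.k =>
    (1 / 2 : ℚ) * ((D l).card : ℚ) < (((D l).filter fun i => I.pref i = 1).card : ℚ)).card

/-- `(γ, d)`-legal partitions. -/
def IsLegal (γ d : ℚ) (D : Fin I.k → Finset (Fin I.n)) : Prop :=
  I.F1 γ D ∧ I.F2 D ∧ I.F3 d D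

/-- `m`-fair partitions. -/
def IsFair (D : Fin I.k → Finset (Fin I.n)) : Prop := I.F4 D

/-- The answer to the fair `(γ, d)`-legal redistricting decision problem is "yes". -/
def IsSatisfiable (γ d : ℚ) : Prop :=
  ∃ D : Fin I.k → Finset (Fin I.n), I.IsPartition D ∧ I.IsLegal γ d D ∧ I.IsFair D

end RedistrictingInstance

/-! ### Planar 3-SAT -/

/-- A 3-SAT instance; every clause has three literals, over three distinct variables.
The `j`-th literal of clause `t` is the variable `var t j` if `sign t j = true`, and its negation
if `sign t j = false`. -/
structure ThreeSAT where
  numVars : ℕ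
  numClauses : ℕ
  var : Fin numClauses → Fin 3 → Fin numVars
  sign : Fin numClauses → Fin 3 → Bool
  var_injective : ∀ t, Function.Injective (var t)

namespace ThreeSAT

variable (φ : ThreeSAT)

/-- Some assignment makes a literal of every clause true. -/
def Satisfiable : Prop :=
  ∃ a : Fin φ.numVars → Bool, ∀ t, ∃ j, a (φ.var t j) = φ.sign t j

/-- The edges of the graph of the instance: `(t, j)` is the edge between the clause vertex of `t`
and the variable vertex of the `j`-th literal of `t`. -/
abbrev Incidence : Type := Fin φ.numClauses × Fin 3

/-- The variable of an edge. -/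
def incVar (e : φ.Incidence) : Fin φ.numVars := φ.var e.1 e.2

/-- The sign with which the variable of an edge appears in the clause of that edge. -/
def incSign (e : φ.Incidence) : Bool := φ.sign e.1 e.2

/-- A planar embedding of the bipartite graph of clause vertices and variable vertices: vertices are
distinct points, edges are simple arcs that contain no vertices except their endpoints and that
intersect at most in common endpoints. -/
structure PlanarEmbedding where
  varPos : Fin φ.numVars → Plane
  clausePos : Fin φ.numClauses → Plane
  vertex_injective : Function.Injective (Sum.elim varPos clausePos)
  arc : ∀ e : φ.Incidence, Path (clausePos e.1) (varPos (φ.incVar e))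
  arc_injective : ∀ e, Function.Injective (arc e)
  arc_vertex : ∀ e s v, arc e s = Sum.elim varPos clausePos v → s = 0 ∨ s = 1
  arc_disjoint : ∀ e e', e ≠ e' → ∀ s s', arc e s = arc e' s' →
    (s = 0 ∨ s = 1) ∧ (s' = 0 ∨ s' = 1)

/-- Planar 3-SAT instances. -/
def IsPlanar : Prop := Nonempty φ.PlanarEmbedding

/-! ### Towns -/

/-- The towns: a big and a small clause town for each clause, two clause-adjacent towns for each
edge `e`, one on either side of the edge (`true`: counterclockwise side as seen from the clause
vertex), and `len e` edge towns in the chain that starts beside the edge `e`. -/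
inductive Town (len : φ.Incidence → ℕ) : Type
  | big (t : Fin φ.numClauses) : Town len
  | small (t : Fin φ.numClauses) : Town len
  | adjacent (e : φ.Incidence) (side : Bool) : Town len
  | edge (e : φ.Incidence) (i : Fin (len e)) : Town len
  deriving DecidableEq, Fintype

/-- The chain of towns that leads from the clockwise clause-adjacent town of `e`, via the `len e`
edge towns, to the counterclockwise clause-adjacent town of `next e`
(which also fills all later positions). -/
def chain (len : φ.Incidence → ℕ) (next : Equiv.Perm φ.Incidence) (e : φ.Incidence) :
    ℕ → φ.Town len
  | 0 => .adjacent e false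
  | i + 1 => if h : i < len e then .edge e ⟨i, h⟩ else .adjacent (next e) true

/-- The data chosen when the towns-and-voters instance of a planar 3-SAT instance is built:
embedding, scales, town locations (before rescaling) and number of voters per big town. -/
structure Construction (γ : ℚ) where
  /-- planar embedding, with integer vertex coordinates -/
  emb : φ.PlanarEmbedding
  varCoord : Fin φ.numVars → ℤ × ℤ
  clauseCoord : Fin φ.numClauses → ℤ × ℤ
  varPos_eq : ∀ x, emb.varPos x = toPlane (((varCoord x).1 : ℚ), ((varCoord x).2 : ℚ))
  clausePos_eq : ∀ t, emb.clausePos t = toPlane (((clauseCoord t).1 : ℚ), ((clauseCoord t).2 : ℚ))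
  /-- the edges at clause vertex `t` leave it at `0`, `2π/3`, `4π/3` radians: edge `(t, j)` has
  number `slot t j` in this list; inside the disk of radius `δ` around the clause vertex they are
  straight, and no other edge enters that disk -/
  slot : Fin φ.numClauses → Equiv.Perm (Fin 3)
  δ : ℝ
  arc_straight : ∀ e : φ.Incidence,
    Set.range (emb.arc e) ∩ Metric.ball (emb.clausePos e.1) δ =
      {p | ∃ r : ℝ, 0 ≤ r ∧ r < δ ∧
        p = emb.clausePos e.1 + polarPoint r (2 * π * ((slot e.1 e.2 : ℕ) : ℝ) / 3)}
  arc_away : ∀ (e : φ.Incidence) (t : Fin φ.numClauses), e.1 ≠ t →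
    Disjoint (Set.range (emb.arc e)) (Metric.ball (emb.clausePos t) δ)
  /-- small scales -/
  η : ℚ
  ε : ℚ
  η_pos : 0 < η
  ε_pos : 0 < ε
  η_small : 200 * (η : ℝ) < δ
  ε_small : 200 * ε < η
  /-- the clause-adjacent towns, at angles `2π(6s ± 1)/18` (up to one degree) for the edge with
  number `s` at its clause vertex, that is, `2πi/18` for `i = 1, 5, 7, 11, 13, 17` -/
  adjPos : φ.Incidence → Bool → ℚ × ℚ
  adjPos_spec : ∀ e side, ∃ r θ : ℝ, (99 / 100 : ℝ) * η ≤ r ∧ r ≤ η ∧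
    |θ - 2 * π * (6 * ((slot e.1 e.2 : ℕ) : ℝ) + (if side then 1 else -1)) / 18| ≤ π / 180 ∧
    toPlane (adjPos e side) = emb.clausePos e.1 + polarPoint r θ
  /-- `next` lists the edges at each variable in the cyclic order in which their ends are met along
  the chains of edge towns around that variable -/
  next : Equiv.Perm φ.Incidence
  next_spec : ∀ e e', next.SameCycle e e' ↔ φ.incVar e = φ.incVar e'
  /-- the edge towns -/
  len : φ.Incidence → ℕ
  edgePos : (e : φ.Incidence) → Fin (len e) → ℚ × ℚ
  /-- the location of every town -/
  pos : φ.Town len → ℚ × ℚ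
  pos_big : ∀ t, pos (.big t) = (((clauseCoord t).1 : ℚ), ((clauseCoord t).2 : ℚ))
  pos_small : ∀ t, pos (.small t) = (((clauseCoord t).1 : ℚ) + ε, ((clauseCoord t).2 : ℚ))
  pos_adjacent : ∀ e side, pos (.adjacent e side) = adjPos e side
  pos_edge : ∀ e i, pos (.edge e i) = edgePos e i
  /-- the edge towns around the variable `x` lie in the set `C_x` of points between `η` and `3η/2`
  away from the edges incident to `x` -/
  edge_mem : ∀ e i,
    (η : ℝ) ≤ Metric.infDist (toPlane (edgePos e i))
      (⋃ (e' : φ.Incidence) (_ : φ.incVar e' = φ.incVar e), Set.range (emb.arc e')) ∧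
    Metric.infDist (toPlane (edgePos e i))
      (⋃ (e' : φ.Incidence) (_ : φ.incVar e' = φ.incVar e), Set.range (emb.arc e')) ≤ 3 / 2 * η
  /-- consecutive towns of a chain are between `0.99η` and `η` apart -/
  chain_step : ∀ e, ∀ i ≤ len e,
    (99 / 100 : ℝ) * η ≤
        ‖toPlane (pos (φ.chain len next e i)) - toPlane (pos (φ.chain len next e (i + 1)))‖ ∧
      ‖toPlane (pos (φ.chain len next e i)) - toPlane (pos (φ.chain len next e (i + 1)))‖ ≤ η
  /-- apart from its two neighbours in its chain, every other town is more than `η + ε` away from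
  an edge town -/
  edge_isolated : ∀ e (i : Fin (len e)) (τ : φ.Town len), τ ≠ .edge e i →
    τ ≠ φ.chain len next e i → τ ≠ φ.chain len next e (i + 2) →
    (η : ℝ) + ε < ‖toPlane (pos (.edge e i)) - toPlane (pos τ)‖
  /-- the number of edge towns between consecutive clause-adjacent towns is even if the signs of
  the variable in the two clauses are equal, and odd if they are opposite -/
  len_parity : ∀ e, Even (len e) ↔ φ.incSign e = φ.incSign (next e)
  /-- number of voters in a big clause town -/
  L : ℕ
  L_dvd : 4 ∣ L
  L_large : 1 / γ ^ 2 < (L : ℚ)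

namespace Construction

variable {φ} {γ : ℚ} (R : φ.Construction γ)

/-- Number of voters with preference `1` in each town. -/
def ones : φ.Town R.len → ℕ
  | .big _ => R.L
  | .small _ => ⌊2 * γ / 3 * (R.L : ℚ)⌋₊
  | .adjacent _ _ => R.L / 4
  | .edge _ _ => R.L / 4 - ⌊γ / 4 * (R.L : ℚ)⌋₊

/-- Number of voters with preference `0` in each town. -/
def zeros : φ.Town R.len → ℕ
  | .big _ => 0
  | .small _ => 0
  | .adjacent _ _ => R.L / 4 + ⌊γ / 6 * (R.L : ℚ)⌋₊
  | .edge _ _ => R.L / 4 + ⌊γ / 4 * (R.L : ℚ)⌋₊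

/-- The voters: each lives in a town and has preference `1` (`inl`) or `0` (`inr`). -/
abbrev Voter : Type := (τ : φ.Town R.len) × (Fin (R.ones τ) ⊕ Fin (R.zeros τ))

/-- The number of towns that are not clause towns. -/
def numOther : ℕ := 6 * φ.numClauses + ∑ e, R.len e

/-- The instance of fair redistricting; all town coordinates are multiplied by `d / (η + ε)`.
The labelling of the voters by `1, …, n` is arbitrary. -/
noncomputable def toInstance (d : ℚ) : RedistrictingInstance where
  n := Fintype.card R.Voter
  k := φ.numClauses + R.numOther / 2
  loc := fun i =>
    let p := R.pos ((Fintype.equivFin R.Voter).symm i).1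
    (d / (R.η + R.ε) * p.1, d / (R.η + R.ε) * p.2)
  m := 2 * φ.numClauses
  pref := fun i => Sum.elim (fun _ => 1) (fun _ => 0) ((Fintype.equivFin R.Voter).symm i).2

end Construction

end ThreeSAT

/-!
Two towns can share a district only if they are at most `η + ε` apart before rescaling. By the
choice of angles and by the isolation of edge towns this leaves few pairs (`near_edge`,
`eq_of_near_adjacent`, `near_big_or_small`): apart from the clause towns, the graph of near towns
consists of one cycle for each variable that occurs, through its chains and the pairs of
clause-adjacent towns beside its edges. No three towns that are not clause towns are pairwise near
(`no_triangle`). A clause town is near only to clause towns and clause-adjacent towns of its clause.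

*From a redistricting to an assignment.* By (F2), districts consist of whole towns
(`exists_districtMap`). The upper bound in (F1) keeps clause-adjacent towns out of the district of a
big clause town, so that the other `k - numClauses` districts have to cover all remaining towns that
are not clause towns; no district takes more than two of them, and the number `k` is such that each
takes exactly two (`exists_partner`). Hence on every cycle the districts form a perfect matching.
Only districts with clause towns have a majority of preference `1`, so (F4) forces every small
clause town into a district of its own, other than that of the big clause town, together with the
two clause-adjacent towns beside some edge. A perfect matching alternates along a chain, and the
parity of the chain lengths makes "the two towns beside `e` are matched" agree with the sign of `e`
either for all edges of a variable or for none (`paired_iff_sign`). This defines an assignment,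
which makes the selected literal of every clause true (`satisfiable_of_districtMap`).

*From an assignment to a redistricting.* Match the two towns beside `e` when the assignment makes
the literal of `e` true, and complete this to the perfect matching of every cycle (`label`). One
small clause town joins the pair beside a true literal of each clause. The district sizes lie
between `L` and `(1 + γ) L`, and the average size exceeds `L` by little enough for (F1)
(`size_bounds`). Convex hulls are disjoint because four towns that span crossing segments of length
at most `η` contain three pairwise near ones (`disjoint_segment_segment`); for the triangle spanned
by a small clause town and two clause-adjacent towns, a segment that enters it has to cross one of
its sides (`exists_mem_side_of_mem_triangle`), and the remaining cases are separated by linear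
functionals or by balls around different clause vertices (`IsBlock.disjoint_hull`).
-/

/-! ### Crossing segments and triangles in the plane -/

/-- If two segments meet, the two pairs of opposite sides of the quadrilateral spanned by their end
points are together at most as long as the two segments. -/
theorem dist_add_dist_le_of_mem_segments {E : Type*} [NormedAddCommGroup E] [NormedSpace ℝ E]
    {a b c d p : E} (h₁ : p ∈ segment ℝ a b) (h₂ : p ∈ segment ℝ c d) :
    dist a c + dist b d ≤ dist a b + dist c d := by
  have e₁ := dist_add_dist_of_mem_segment h₁
  have e₂ := dist_add_dist_of_mem_segment h₂
  have t₁ := dist_triangle a p c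
  have t₂ := dist_triangle b p d
  rw [dist_comm p c] at t₁
  rw [dist_comm b p] at t₂
  linarith

theorem inner_plane (p q : Plane) : inner ℝ p q = p 0 * q 0 + p 1 * q 1 := by
  simp [PiLp.inner_apply, Fin.sum_univ_two, mul_comm]

/-- Twice the signed area of the triangle with vertices `w`, `a`, `b`. -/
def cross (w a b : Plane) : ℝ := (a 0 - w 0) * (b 1 - w 1) - (a 1 - w 1) * (b 0 - w 0)

/-- A nondegenerate triangle gives barycentric coordinates to all points of the plane. -/
theorem exists_barycentric {w a b : Plane} (h : cross w a b ≠ 0) (x : Plane) :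
    ∃ c₀ c₁ c₂ : ℝ, c₀ + c₁ + c₂ = 1 ∧ x = c₀ • w + c₁ • a + c₂ • b := by
  refine ⟨1 - cross w x b / cross w a b - cross w a x / cross w a b,
    cross w x b / cross w a b, cross w a x / cross w a b, by ring, ?_⟩
  ext i
  fin_cases i
  · simp only [Fin.zero_eta, Fin.isValue, PiLp.add_apply, PiLp.smul_apply, smul_eq_mul]
    field_simp
    simp only [cross]
    ring
  · simp only [Fin.mk_one, Fin.isValue, PiLp.add_apply, PiLp.smul_apply, smul_eq_mul]
    field_simp
    simp only [cross]
    ring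

theorem mem_convexHull_triple {E : Type*} [AddCommGroup E] [Module ℝ E] {w a b x : E} :
    x ∈ convexHull ℝ {w, a, b} ↔ ∃ c₀ c₁ c₂ : ℝ, 0 ≤ c₀ ∧ 0 ≤ c₁ ∧ 0 ≤ c₂ ∧ c₀ + c₁ + c₂ = 1 ∧
      x = c₀ • w + c₁ • a + c₂ • b := by
  rw [convexHull_insert (by simp), convexHull_pair, mem_convexJoin]
  constructor
  · rintro ⟨_, rfl, q, ⟨s, t, hs, ht, hst, rfl⟩, ⟨u, v, hu, hv, huv, rfl⟩⟩
    refine ⟨u, v * s, v * t, hu, by positivity, by positivity, ?_, ?_⟩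
    · rw [add_assoc, ← mul_add, hst, mul_one, huv]
    · rw [smul_add, smul_smul, smul_smul, add_assoc]
  · rintro ⟨c₀, c₁, c₂, h₀, h₁, h₂, hs, rfl⟩
    refine ⟨w, rfl, ?_⟩
    rcases (add_nonneg h₁ h₂).eq_or_lt with h | h
    · have e₁ : c₁ = 0 := by linarith
      have e₂ : c₂ = 0 := by linarith
      exact ⟨a, left_mem_segment _ _ _, c₀, 0, h₀, le_rfl, by linarith, by simp [e₁, e₂]⟩
    · refine ⟨(c₁ / (c₁ + c₂)) • a + (c₂ / (c₁ + c₂)) • b,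
        ⟨_, _, by positivity, by positivity, by field_simp, rfl⟩,
        c₀, c₁ + c₂, h₀, h.le, by linarith, ?_⟩
      rw [smul_add, smul_smul, smul_smul, mul_div_cancel₀ _ h.ne', mul_div_cancel₀ _ h.ne',
        add_assoc]

/-- A segment that meets a nondegenerate triangle in the plane and has an end point outside meets
one of its sides. -/
theorem exists_mem_side_of_mem_triangle {w a b x y p : Plane} (h : cross w a b ≠ 0)
    (hp : p ∈ convexHull ℝ {w, a, b}) (hpxy : p ∈ segment ℝ x y)
    (hx : x ∉ convexHull ℝ {w, a, b}) :
    ∃ q ∈ segment ℝ x y, q ∈ segment ℝ w a ∨ q ∈ segment ℝ w b ∨ q ∈ segment ℝ a b := by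
  obtain ⟨p₀, p₁, p₂, h₀, h₁, h₂, hps, hpe⟩ := mem_convexHull_triple.1 hp
  obtain ⟨x₀, x₁, x₂, hxs, hxe⟩ := exists_barycentric h x
  -- The least barycentric coordinate changes sign between `p` and `x`.
  have hc : Continuous fun t : ℝ => min ((1 - t) * p₀ + t * x₀)
      (min ((1 - t) * p₁ + t * x₁) ((1 - t) * p₂ + t * x₂)) := by fun_prop
  have hneg : min x₀ (min x₁ x₂) ≤ 0 := by
    by_contra! hpos
    simp only [lt_min_iff] at hpos
    exact hx (mem_convexHull_triple.2
      ⟨x₀, x₁, x₂, hpos.1.le, hpos.2.1.le, hpos.2.2.le, hxs, hxe⟩)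
  obtain ⟨t, ⟨ht₀, ht₁⟩, ht⟩ := intermediate_value_Icc' (zero_le_one' ℝ) hc.continuousOn
    (show (0 : ℝ) ∈ Set.Icc _ _ by
      refine ⟨by simpa using hneg, ?_⟩
      simp [h₀, h₁, h₂])
  simp only at ht
  set c₀ := (1 - t) * p₀ + t * x₀ with hc₀
  set c₁ := (1 - t) * p₁ + t * x₁ with hc₁
  set c₂ := (1 - t) * p₂ + t * x₂ with hc₂
  have hsum : c₀ + c₁ + c₂ = 1 := by
    rw [hc₀, hc₁, hc₂]
    linear_combination (1 - t) * hps + t * hxs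
  have hn := ht.symm.le
  simp only [le_min_iff] at hn
  obtain ⟨n₀, n₁, n₂⟩ := hn
  refine ⟨c₀ • w + c₁ • a + c₂ • b, ?_, ?_⟩
  · have hq : c₀ • w + c₁ • a + c₂ • b = (1 - t) • p + t • x := by
      rw [hpe]
      conv_rhs => rw [hxe]
      rw [hc₀, hc₁, hc₂]
      module
    rw [hq]
    exact (convex_segment x y) hpxy (left_mem_segment _ _ _) (by linarith) ht₀ (by ring)
  · have hz : c₀ = 0 ∨ c₁ = 0 ∨ c₂ = 0 := by
      by_contra! hne
      have := lt_min (lt_of_le_of_ne n₀ hne.1.symm)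
        (lt_min (lt_of_le_of_ne n₁ hne.2.1.symm) (lt_of_le_of_ne n₂ hne.2.2.symm))
      exact this.ne' ht
    rcases hz with hz | hz | hz
    · exact Or.inr (Or.inr ⟨c₁, c₂, n₁, n₂, by linarith, by simp [hz]⟩)
    · exact Or.inr (Or.inl ⟨c₀, c₂, n₀, n₂, by linarith, by simp [hz]⟩)
    · exact Or.inl ⟨c₀, c₁, n₀, n₁, by linarith, by simp [hz]⟩

/-- A linear functional that is at most `c` on `s` and greater than `c` on `t` separates the convex
hulls of `s` and `t`. -/
theorem disjoint_convexHull_of_inner {s t : Set Plane} (u : Plane) (c : ℝ)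
    (hs : ∀ x ∈ s, inner ℝ u x ≤ c) (ht : ∀ x ∈ t, c < inner ℝ u x) :
    Disjoint (convexHull ℝ s) (convexHull ℝ t) := by
  have hl : IsLinearMap ℝ fun x : Plane => inner ℝ u x :=
    ⟨fun x y => inner_add_right u x y, fun r x => by simp [inner_smul_right]⟩
  have h₁ : convexHull ℝ s ⊆ {x | inner ℝ u x ≤ c} :=
    convexHull_min hs (convex_halfSpace_le hl c)
  have h₂ : convexHull ℝ t ⊆ {x | c < inner ℝ u x} :=
    convexHull_min ht (convex_halfSpace_gt hl c)
  rw [Set.disjoint_left]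
  intro x hx hx'
  exact absurd (show c < inner ℝ u x from h₂ hx') (not_lt.2 (h₁ hx))

theorem disjoint_convexHull_of_closedBall {s t : Set Plane} {a b : Plane} {r : ℝ}
    (hs : s ⊆ Metric.closedBall a r) (ht : t ⊆ Metric.closedBall b r) (h : 2 * r < dist a b) :
    Disjoint (convexHull ℝ s) (convexHull ℝ t) :=
  (Metric.closedBall_disjoint_closedBall (by linarith)).mono
    (convexHull_min hs (convex_closedBall a r)) (convexHull_min ht (convex_closedBall b r))

/-! ### Points in polar coordinates -/

theorem inner_polarPoint (r r' θ θ' : ℝ) :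
    inner ℝ (polarPoint r θ) (polarPoint r' θ') = r * r' * Real.cos (θ - θ') := by
  rw [inner_plane, Real.cos_sub]
  simp only [polarPoint, PiLp.toLp_apply, Matrix.cons_val_zero, Matrix.cons_val_one]
  ring

theorem norm_polarPoint {r : ℝ} (hr : 0 ≤ r) (θ : ℝ) : ‖polarPoint r θ‖ = r := by
  have h : ‖polarPoint r θ‖ ^ 2 = r ^ 2 := by
    rw [← real_inner_self_eq_norm_sq, inner_polarPoint]
    simp [sq]
  exact (sq_eq_sq₀ (norm_nonneg _) hr).1 h

theorem norm_sub_polarPoint_sq (r r' θ θ' : ℝ) :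
    ‖polarPoint r θ - polarPoint r' θ'‖ ^ 2 =
      r ^ 2 + r' ^ 2 - 2 * r * r' * Real.cos (θ - θ') := by
  rw [norm_sub_sq_real, inner_polarPoint, ← real_inner_self_eq_norm_sq,
    ← real_inner_self_eq_norm_sq, inner_polarPoint, inner_polarPoint]
  simp
  ring

/-- The nominal angle of the town on the given side of the edge number `s` at its clause. -/
noncomputable def sideAngle (s : Fin 3) (side : Bool) : ℝ :=
  2 * π * (6 * ((s : ℕ) : ℝ) + (if side then 1 else -1)) / 18

/-- Directions beside the same edge differ by at most `42` degrees. -/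
theorem cos_sub_ge_of_sideAngle {s : Fin 3} {b b' : Bool} {θ θ' : ℝ}
    (h : |θ - sideAngle s b| ≤ π / 180) (h' : |θ' - sideAngle s b'| ≤ π / 180) :
    7 / 10 ≤ Real.cos (θ - θ') := by
  have hd : |θ - θ'| ≤ π / 4 := by
    have := Real.pi_pos
    rw [abs_le] at h h' ⊢
    cases b <;> cases b' <;>
      simp only [sideAngle, if_true, if_false, Bool.false_eq_true] at h h' <;>
      constructor <;> linarith [h.1, h.2, h'.1, h'.2]
  have := Real.cos_le_cos_of_nonneg_of_le_pi (abs_nonneg _) (by linarith [Real.pi_pos]) hd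
  rw [Real.cos_abs, Real.cos_pi_div_four] at this
  have h2 : (7 / 5 : ℝ) ≤ √2 := Real.le_sqrt_of_sq_le (by norm_num)
  linarith

/-- Directions beside different edges of a clause differ by at least `78` degrees. -/
theorem cos_sub_le_of_sideAngle {s s' : Fin 3} (hs : s ≠ s') {b b' : Bool} {θ θ' : ℝ}
    (h : |θ - sideAngle s b| ≤ π / 180) (h' : |θ' - sideAngle s' b'| ≤ π / 180) :
    Real.cos (θ - θ') ≤ 21 / 100 := by
  have hpi := Real.pi_pos
  have hd : |(|θ - θ'| - π)| ≤ π / 2 + π / 15 := by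
    rw [abs_le] at h h'
    have key : 78 * π / 180 ≤ |θ - θ'| ∧ |θ - θ'| ≤ 282 * π / 180 := by
      rw [abs_le, le_abs]
      fin_cases s <;> fin_cases s' <;> first | exact absurd rfl hs | skip
      all_goals
        cases b <;> cases b' <;>
        simp [sideAngle] at h h' <;>
        (refine ⟨?_, by linarith [h.1, h.2, h'.1, h'.2], by linarith [h.1, h.2, h'.1, h'.2]⟩) <;>
        first
          | exact Or.inl (by linarith [h.1, h.2, h'.1, h'.2])
          | exact Or.inr (by linarith [h.1, h.2, h'.1, h'.2])
    rw [abs_le]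
    constructor <;> linarith [key.1, key.2]
  have hc := Real.cos_le_cos_of_nonneg_of_le_pi (abs_nonneg _) (by linarith) hd
  rw [Real.cos_abs, Real.cos_sub_pi, Real.cos_abs, add_comm, Real.cos_add_pi_div_two] at hc
  have := Real.sin_le (show 0 ≤ π / 15 by positivity)
  linarith [Real.pi_lt_d2]

/-- The direction that separates a clause vertex from the triangle beside edge number `s`. -/
noncomputable def sepAngle (s : Fin 3) : ℝ := ![0, π / 3, 5 * π / 3] s

theorem cos_sepAngle_pos (s : Fin 3) : 0 < Real.cos (sepAngle s) := by
  have e : Real.cos (5 * π / 3) = Real.cos (π / 3) := by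
    rw [← Real.cos_neg, ← Real.cos_add_two_pi]
    congr 1
    ring
  fin_cases s <;> simp [sepAngle, e]

theorem cos_sub_sepAngle_pos {s : Fin 3} {b : Bool} {θ : ℝ}
    (h : |θ - sideAngle s b| ≤ π / 180) : 0 < Real.cos (sepAngle s - θ) := by
  have hpi := Real.pi_pos
  rw [abs_le] at h
  apply Real.cos_pos_of_mem_Ioo
  fin_cases s <;> cases b <;> simp [sideAngle, sepAngle] at h ⊢ <;> constructor <;>
    linarith [h.1, h.2]

/-- The directions on the two sides of an edge differ by between `38` and `42` degrees. -/
theorem sin_sub_ge_of_sideAngle {s : Fin 3} {θ θ' : ℝ}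
    (h : |θ - sideAngle s false| ≤ π / 180) (h' : |θ' - sideAngle s true| ≤ π / 180) :
    1 / 2 ≤ Real.sin (θ' - θ) := by
  have hpi := Real.pi_pos
  rw [← Real.sin_pi_div_six]
  rw [abs_le] at h h'
  simp only [sideAngle, if_true, if_false, Bool.false_eq_true] at h h'
  apply Real.sin_le_sin_of_le_of_le_pi_div_two <;> linarith [h.1, h.2, h'.1, h'.2]

theorem cross_polarPoint (v : Plane) (ε r r' θ θ' : ℝ) :
    cross (v + polarPoint ε 0) (v + polarPoint r θ) (v + polarPoint r' θ') =
      r * r' * Real.sin (θ' - θ) - ε * (r' * Real.sin θ' - r * Real.sin θ) := by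
  rw [Real.sin_sub]
  simp only [cross, polarPoint, PiLp.add_apply, Matrix.cons_val_zero,
    Matrix.cons_val_one, Real.cos_zero, Real.sin_zero]
  ring

namespace ThreeSAT

/-! ### Chains of towns -/

section Chain

variable {φ : ThreeSAT} {len : φ.Incidence → ℕ} {next : Equiv.Perm φ.Incidence}

theorem chain_succ_of_lt {e : φ.Incidence} {i : ℕ} (h : i < len e) :
    φ.chain len next e (i + 1) = .edge e ⟨i, h⟩ := by
  simp [chain, h]

theorem chain_succ_of_le {e : φ.Incidence} {i : ℕ} (h : len e ≤ i) :
    φ.chain len next e (i + 1) = .adjacent (next e) true := by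
  simp [chain, not_lt.2 h]

theorem chain_eq_edge_iff {e e' : φ.Incidence} {i : Fin (len e)} {p : ℕ} :
    φ.chain len next e' p = .edge e i ↔ e' = e ∧ p = i + 1 := by
  cases p with
  | zero => simp [chain]
  | succ p =>
    by_cases h : p < len e'
    · rw [chain_succ_of_lt h]
      constructor
      · intro h'
        cases h'
        simp
      · rintro ⟨rfl, h'⟩
        congr 1
        ext
        simpa using h'
    · rw [chain_succ_of_le (not_lt.1 h)]
      simp only [reduceCtorEq, false_iff]
      rintro ⟨rfl, h'⟩
      have := i.2
      omega

theorem chain_eq_adjacent_false_iff {e e' : φ.Incidence} {p : ℕ} :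
    φ.chain len next e' p = .adjacent e false ↔ e' = e ∧ p = 0 := by
  cases p with
  | zero => simp [chain]
  | succ p =>
    by_cases h : p < len e'
    · simp [chain_succ_of_lt h]
    · simp [chain_succ_of_le (not_lt.1 h)]

theorem chain_eq_adjacent_true_iff {e e' : φ.Incidence} {p : ℕ} :
    φ.chain len next e' p = .adjacent e true ↔ next e' = e ∧ len e' + 1 ≤ p := by
  cases p with
  | zero => simp [chain]
  | succ p =>
    by_cases h : p < len e'
    · simp [chain_succ_of_lt h]
      omega
    · simp [chain_succ_of_le (not_lt.1 h)]
      omega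

theorem chain_ne_big (e : φ.Incidence) (p : ℕ) (t) : φ.chain len next e p ≠ .big t := by
  cases p with
  | zero => simp [chain]
  | succ p => by_cases h : p < len e <;> simp [chain, h]

theorem chain_ne_small (e : φ.Incidence) (p : ℕ) (t) : φ.chain len next e p ≠ .small t := by
  cases p with
  | zero => simp [chain]
  | succ p => by_cases h : p < len e <;> simp [chain, h]

theorem chain_injOn {e : φ.Incidence} {p q : ℕ} (hp : p ≤ len e + 1) (hq : q ≤ len e + 1)
    (h : φ.chain len next e p = φ.chain len next e q) : p = q := by
  rcases q with _ | q
  · exact (chain_eq_adjacent_false_iff.1 h).2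
  · by_cases hl : q < len e
    · rw [chain_succ_of_lt hl, chain_eq_edge_iff] at h
      exact h.2
    · rw [chain_succ_of_le (not_lt.1 hl), chain_eq_adjacent_true_iff] at h
      omega

end Chain

/-- The towns that are not clause towns. -/
def Town.IsOther {φ : ThreeSAT} {len : φ.Incidence → ℕ} : φ.Town len → Prop
  | .big _ => False
  | .small _ => False
  | .adjacent _ _ => True
  | .edge _ _ => True

theorem isOther_chain {φ : ThreeSAT} {len : φ.Incidence → ℕ} {next : Equiv.Perm φ.Incidence}
    (e : φ.Incidence) (p : ℕ) : (φ.chain len next e p).IsOther := by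
  cases p with
  | zero => trivial
  | succ p => by_cases h : p < len e <;> simp [chain, h, Town.IsOther]

namespace Construction

variable {φ : ThreeSAT} {γ : ℚ} (R : φ.Construction γ)

/-! ### Distances between towns -/

/-- The location of a town, before rescaling. -/
noncomputable def place (τ : φ.Town R.len) : Plane := toPlane (R.pos τ)

/-- Two towns are near if, after rescaling, they are at most `d` apart. -/
def Near (τ σ : φ.Town R.len) : Prop := dist (R.place τ) (R.place σ) ≤ R.η + R.ε

variable {R} in
theorem Near.symm {τ σ : φ.Town R.len} (h : R.Near τ σ) : R.Near σ τ := by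
  unfold Near at *
  rwa [dist_comm]

theorem η_pos' : (0 : ℝ) < R.η := by exact_mod_cast R.η_pos

theorem ε_pos' : (0 : ℝ) < R.ε := by exact_mod_cast R.ε_pos

theorem ε_small' : 200 * (R.ε : ℝ) < R.η := by exact_mod_cast R.ε_small

theorem near_of_dist_le {τ σ : φ.Town R.len} (h : dist (R.place τ) (R.place σ) ≤ R.η) :
    R.Near τ σ := by
  have := R.ε_pos'
  unfold Near
  linarith

theorem place_big (t : Fin φ.numClauses) : R.place (.big t) = R.emb.clausePos t := by
  rw [place, R.pos_big, R.clausePos_eq]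

theorem place_small (t : Fin φ.numClauses) :
    R.place (.small t) = R.emb.clausePos t + polarPoint R.ε 0 := by
  rw [place, R.pos_small, R.clausePos_eq]
  ext i
  fin_cases i <;> simp [toPlane, polarPoint]

theorem place_adjacent (e : φ.Incidence) (side : Bool) :
    ∃ r θ : ℝ, (99 / 100 : ℝ) * R.η ≤ r ∧ r ≤ R.η ∧
      |θ - sideAngle (R.slot e.1 e.2) side| ≤ π / 180 ∧
      R.place (.adjacent e side) = R.emb.clausePos e.1 + polarPoint r θ := by
  obtain ⟨r, θ, h₁, h₂, h₃, h₄⟩ := R.adjPos_spec e side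
  refine ⟨r, θ, h₁, h₂, h₃, ?_⟩
  rw [place, R.pos_adjacent, h₄]

theorem dist_clausePos_lt {t t' : Fin φ.numClauses} (h : t ≠ t') :
    200 * (R.η : ℝ) < dist (R.emb.clausePos t) (R.emb.clausePos t') := by
  -- The arcs at `t` start at its vertex and avoid the disk around `t'`.
  have h₁ := R.arc_away (t, 0) t' h
  have h₂ : R.emb.clausePos t ∈ Set.range (R.emb.arc (t, 0)) := ⟨0, by simp⟩
  have h₃ := Set.disjoint_left.1 h₁ h₂
  rw [Metric.mem_ball, not_lt] at h₃
  exact R.η_small.trans_le h₃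

theorem dist_place_big (t : Fin φ.numClauses) :
    dist (R.place (.big t)) (R.emb.clausePos t) ≤ R.η := by
  rw [place_big, dist_self]
  exact R.η_pos'.le

theorem dist_place_small (t : Fin φ.numClauses) :
    dist (R.place (.small t)) (R.emb.clausePos t) = R.ε := by
  rw [place_small, dist_eq_norm, add_sub_cancel_left, norm_polarPoint R.ε_pos'.le]

theorem dist_place_small_le (t : Fin φ.numClauses) :
    dist (R.place (.small t)) (R.emb.clausePos t) ≤ R.η := by
  rw [dist_place_small]
  linarith [R.ε_small', R.ε_pos']

theorem dist_place_adjacent (e : φ.Incidence) (side : Bool) :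
    99 / 100 * (R.η : ℝ) ≤ dist (R.place (.adjacent e side)) (R.emb.clausePos e.1) ∧
      dist (R.place (.adjacent e side)) (R.emb.clausePos e.1) ≤ R.η := by
  obtain ⟨r, θ, h₁, h₂, -, h₄⟩ := R.place_adjacent e side
  rw [h₄, dist_eq_norm, add_sub_cancel_left, norm_polarPoint (by linarith [R.η_pos'])]
  exact ⟨h₁, h₂⟩

theorem clause_eq_of_near {τ τ' : φ.Town R.len} {t t' : Fin φ.numClauses}
    (h : dist (R.place τ) (R.emb.clausePos t) ≤ R.η)
    (h' : dist (R.place τ') (R.emb.clausePos t') ≤ R.η) (hn : R.Near τ τ') : t = t' := by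
  by_contra hne
  have h₀ := R.dist_clausePos_lt hne
  have h₁ := dist_triangle4 (R.emb.clausePos t) (R.place τ) (R.place τ') (R.emb.clausePos t')
  rw [dist_comm (R.emb.clausePos t) (R.place τ)] at h₁
  unfold Near at hn
  linarith [R.η_pos', R.ε_small']

theorem dist_adjacent_same (e : φ.Incidence) (b b' : Bool) :
    dist (R.place (.adjacent e b)) (R.place (.adjacent e b')) ≤ 8 / 10 * R.η := by
  obtain ⟨r, θ, h₁, h₂, h₃, h₄⟩ := R.place_adjacent e b
  obtain ⟨r', θ', h₁', h₂', h₃', h₄'⟩ := R.place_adjacent e b'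
  have hc := cos_sub_ge_of_sideAngle h₃ h₃'
  have hη := R.η_pos'
  rw [h₄, h₄', dist_eq_norm, add_sub_add_left_eq_sub]
  apply le_of_sq_le_sq _ (by positivity)
  rw [norm_sub_polarPoint_sq]
  have hr : 0 < r * r' := mul_pos (by linarith) (by linarith)
  have h6 := mul_le_mul_of_nonneg_left hc hr.le
  have h7 : r * r' ≤ R.η * R.η := mul_le_mul h₂ h₂' (by linarith) hη.le
  have h8 : (r - r') ^ 2 ≤ (R.η / 100) ^ 2 := by
    rw [sq_le_sq, abs_of_pos (show (0 : ℝ) < R.η / 100 by positivity), abs_le]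
    constructor <;> linarith
  nlinarith [sq_nonneg (R.η : ℝ)]

theorem dist_adjacent_ne {e e' : φ.Incidence} (he : e.1 = e'.1) (hne : e ≠ e') (b b' : Bool) :
    11 / 10 * (R.η : ℝ) < dist (R.place (.adjacent e b)) (R.place (.adjacent e' b')) := by
  obtain ⟨r, θ, h₁, h₂, h₃, h₄⟩ := R.place_adjacent e b
  obtain ⟨r', θ', h₁', h₂', h₃', h₄'⟩ := R.place_adjacent e' b'
  have hs : R.slot e.1 e.2 ≠ R.slot e'.1 e'.2 := by
    rw [← he]
    exact fun h => hne (Prod.ext he ((R.slot e.1).injective h))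
  have hc := cos_sub_le_of_sideAngle hs h₃ h₃'
  have hη := R.η_pos'
  rw [h₄, h₄', ← he, dist_eq_norm, add_sub_add_left_eq_sub]
  apply lt_of_pow_lt_pow_left₀ 2 (norm_nonneg _)
  rw [norm_sub_polarPoint_sq]
  have hr : 0 < r * r' := mul_pos (by linarith) (by linarith)
  have h6 := mul_le_mul_of_nonneg_left hc hr.le
  have h7 : (99 / 100 * R.η) * (99 / 100 * R.η) ≤ r * r' :=
    mul_le_mul h₁ h₁' (by positivity) (by linarith)
  nlinarith [sq_nonneg (r - r'), sq_pos_of_pos hη]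

/-! ### Which towns are near -/

theorem near_edge {e : φ.Incidence} {i : Fin (R.len e)} {τ : φ.Town R.len}
    (h : R.Near (.edge e i) τ) (hne : τ ≠ .edge e i) :
    τ = φ.chain R.len R.next e i ∨ τ = φ.chain R.len R.next e (i + 2) := by
  by_contra! hc
  have := R.edge_isolated e i τ hne hc.1 hc.2
  rw [← dist_eq_norm] at this
  exact absurd h (not_le.2 this)

theorem eq_of_near_adjacent {e e' : φ.Incidence} {b b' : Bool}
    (h : R.Near (.adjacent e b) (.adjacent e' b')) : e = e' := by
  by_contra hne
  have he := R.clause_eq_of_near (R.dist_place_adjacent e b).2 (R.dist_place_adjacent e' b').2 h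
  have := R.dist_adjacent_ne he hne b b'
  unfold Near at h
  linarith [R.η_pos', R.ε_small']

theorem near_big_or_small {t : Fin φ.numClauses} {τ σ : φ.Town R.len}
    (hτ : τ = .big t ∨ τ = .small t) (h : R.Near τ σ) :
    σ = .big t ∨ σ = .small t ∨ ∃ e b, e.1 = t ∧ σ = .adjacent e b := by
  have hd : dist (R.place τ) (R.emb.clausePos t) ≤ R.η := by
    rcases hτ with rfl | rfl
    · exact R.dist_place_big t
    · exact R.dist_place_small_le t
  cases σ with
  | big t' => exact Or.inl (by rw [R.clause_eq_of_near hd (R.dist_place_big t') h])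
  | small t' => exact Or.inr (Or.inl (by rw [R.clause_eq_of_near hd (R.dist_place_small_le t') h]))
  | adjacent e b =>
    exact Or.inr (Or.inr ⟨e, b, (R.clause_eq_of_near hd (R.dist_place_adjacent e b).2 h).symm, rfl⟩)
  | edge e i =>
    exfalso
    rcases R.near_edge h.symm (by rcases hτ with rfl | rfl <;> simp) with h' | h' <;>
      rcases hτ with rfl | rfl <;>
      first
        | exact chain_ne_big _ _ _ h'.symm
        | exact chain_ne_small _ _ _ h'.symm

theorem dist_chain_le (e : φ.Incidence) {i : ℕ} (hi : i ≤ R.len e) :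
    dist (R.place (φ.chain R.len R.next e i)) (R.place (φ.chain R.len R.next e (i + 1))) ≤ R.η := by
  rw [dist_eq_norm]
  exact (R.chain_step e i hi).2

/-- The two ends of a chain lie beside different clauses, or beside the same edge and hence less
than `99η/100` apart; so a chain has an edge town. -/
theorem len_pos (e : φ.Incidence) : 0 < R.len e := by
  by_contra! h0
  have h0 : R.len e = 0 := by omega
  have hs := R.chain_step e 0 (by omega)
  rw [chain_succ_of_le h0.le, ← dist_eq_norm] at hs
  have h1 : e = R.next e := R.eq_of_near_adjacent (R.near_of_dist_le hs.2)
  have h2 := R.dist_adjacent_same e false true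
  rw [← h1] at hs
  have := hs.1.trans h2
  linarith [R.η_pos']

theorem not_near_chain_two {e : φ.Incidence} {i : ℕ} (hi : i < R.len e) :
    ¬ R.Near (φ.chain R.len R.next e i) (φ.chain R.len R.next e (i + 2)) := by
  intro h
  rcases i with _ | j
  · by_cases h1 : 1 < R.len e
    · rw [chain_succ_of_lt h1] at h
      rcases R.near_edge h.symm (by simp [chain]) with h' | h'
      · exact absurd (chain_eq_adjacent_false_iff.1 h'.symm).2 (by simp)
      · exact absurd (chain_eq_adjacent_false_iff.1 h'.symm).2 (by simp)
    · rw [chain_succ_of_le (by omega)] at h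
      have h2 : e = R.next e := R.eq_of_near_adjacent h
      have h3 := R.len_parity e
      rw [← h2, show R.len e = 1 by omega] at h3
      simp at h3
  · have hj : j < R.len e := by omega
    rw [chain_succ_of_lt hj] at h
    have hne : φ.chain R.len R.next e (j + 1 + 2) ≠ .edge e ⟨j, hj⟩ := by
      intro h'
      have := (chain_eq_edge_iff.1 h').2
      simp at this
    rcases R.near_edge h hne with h' | h'
    · have := chain_injOn (by omega) (by simp; omega) h'
      dsimp only at this
      omega
    · have := chain_injOn (by omega) (by simp; omega) h'
      dsimp only at this
      omega

theorem no_triangle_edge {e : φ.Incidence} {i : Fin (R.len e)} {b c : φ.Town R.len}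
    (hb : b ≠ .edge e i) (hc : c ≠ .edge e i) (hbc : b ≠ c)
    (nb : R.Near (.edge e i) b) (nc : R.Near (.edge e i) c) (n : R.Near b c) : False := by
  rcases R.near_edge nb hb with rfl | rfl <;> rcases R.near_edge nc hc with rfl | rfl
  · exact hbc rfl
  · exact R.not_near_chain_two i.2 n
  · exact R.not_near_chain_two i.2 n.symm
  · exact hbc rfl

/-- Among the towns that are not clause towns, no three are pairwise near. -/
theorem no_triangle {a b c : φ.Town R.len} (ha : a.IsOther) (hb : b.IsOther) (hc : c.IsOther)
    (hab : a ≠ b) (hac : a ≠ c) (hbc : b ≠ c)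
    (nab : R.Near a b) (nac : R.Near a c) (nbc : R.Near b c) : False := by
  cases a with
  | big => exact ha
  | small => exact ha
  | edge e i => exact R.no_triangle_edge hab.symm hac.symm hbc nab nac nbc
  | adjacent e s =>
    cases b with
    | big => exact hb
    | small => exact hb
    | edge e i => exact R.no_triangle_edge hab hbc.symm hac nab.symm nbc nac
    | adjacent e' s' =>
      cases c with
      | big => exact hc
      | small => exact hc
      | edge e i => exact R.no_triangle_edge hac hbc hab nac.symm nbc.symm nab
      | adjacent e'' s'' =>
        obtain rfl := R.eq_of_near_adjacent nab
        obtain rfl := R.eq_of_near_adjacent nac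
        revert hab hac hbc
        cases s <;> cases s' <;> cases s'' <;> simp

/-! ### Disjointness of the hulls of town sets -/

/-- Crossing segments would yield three pairwise near towns. -/
theorem disjoint_segment_segment {a b c d : φ.Town R.len} (ha : a.IsOther) (hb : b.IsOther)
    (hc : c.IsOther) (hd : d.IsOther) (hab : a ≠ b) (hcd : c ≠ d) (hac : a ≠ c) (had : a ≠ d)
    (hbc : b ≠ c) (hbd : b ≠ d) (dab : dist (R.place a) (R.place b) ≤ R.η)
    (dcd : dist (R.place c) (R.place d) ≤ R.η) :
    Disjoint (segment ℝ (R.place a) (R.place b)) (segment ℝ (R.place c) (R.place d)) := by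
  rw [Set.disjoint_left]
  intro p hp hq
  have nab := R.near_of_dist_le dab
  have ncd := R.near_of_dist_le dcd
  have k₁ := dist_add_dist_le_of_mem_segments hp hq
  rw [segment_symm] at hq
  have k₂ := dist_add_dist_le_of_mem_segments hp hq
  rw [dist_comm (R.place d)] at k₂
  -- The sums are at most `2η`, so one summand of each is at most `η`.
  have c₁ : R.Near a c ∨ R.Near b d := by
    by_contra! hn
    unfold Near at hn
    linarith [R.ε_pos', hn.1, hn.2]
  have c₂ : R.Near a d ∨ R.Near b c := by
    by_contra! hn
    unfold Near at hn
    linarith [R.ε_pos', hn.1, hn.2]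
  rcases c₁ with h₁ | h₁ <;> rcases c₂ with h₂ | h₂
  · exact R.no_triangle ha hc hd hac had hcd h₁ h₂ ncd
  · exact R.no_triangle ha hb hc hab hac hbc nab h₁ h₂
  · exact R.no_triangle ha hb hd hab had hbd nab h₂ h₁
  · exact R.no_triangle hb hc hd hbc hbd hcd h₂ h₁ ncd

theorem le_dist_big {a : φ.Town R.len} (ha : a.IsOther) (t : Fin φ.numClauses) :
    99 / 100 * (R.η : ℝ) ≤ dist (R.place (.big t)) (R.place a) := by
  by_contra! h
  have hn : R.Near (.big t) a := R.near_of_dist_le (by linarith [R.η_pos'])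
  rcases R.near_big_or_small (Or.inl rfl) hn with rfl | rfl | ⟨e, b, rfl, rfl⟩
  · exact ha
  · exact ha
  · rw [place_big, dist_comm] at h
    exact absurd h (not_lt.2 (R.dist_place_adjacent e b).1)

theorem big_notMem_segment {a b : φ.Town R.len} (ha : a.IsOther) (hb : b.IsOther)
    (dab : dist (R.place a) (R.place b) ≤ R.η) (t : Fin φ.numClauses) :
    R.place (.big t) ∉ segment ℝ (R.place a) (R.place b) := by
  intro h
  have h₀ := dist_add_dist_of_mem_segment h
  have h₁ := R.le_dist_big ha t
  have h₂ := R.le_dist_big hb t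
  rw [dist_comm] at h₁
  linarith [R.η_pos']

/-- The small clause town and the two clause-adjacent towns beside the edge `e`. -/
def corners (e : φ.Incidence) : Set Plane :=
  {R.place (.small e.1), R.place (.adjacent e false), R.place (.adjacent e true)}

theorem corners_subset_closedBall (e : φ.Incidence) :
    R.corners e ⊆ Metric.closedBall (R.emb.clausePos e.1) R.η := by
  rintro x (rfl | rfl | rfl)
  · exact R.dist_place_small_le e.1
  · exact (R.dist_place_adjacent e false).2
  · exact (R.dist_place_adjacent e true).2

theorem dist_small_adjacent (e : φ.Incidence) (b : Bool) :
    dist (R.place (.small e.1)) (R.place (.adjacent e b)) ≤ R.η + R.ε := by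
  have h := dist_triangle (R.place (.small e.1)) (R.emb.clausePos e.1) (R.place (.adjacent e b))
  rw [R.dist_place_small, dist_comm (R.emb.clausePos e.1)] at h
  linarith [(R.dist_place_adjacent e b).2]

theorem corners_subset_closedBall_small (e : φ.Incidence) :
    R.corners e ⊆ Metric.closedBall (R.place (.small e.1)) (R.η + R.ε) := by
  have := R.η_pos'
  have := R.ε_pos'
  rintro x (rfl | rfl | rfl)
  · exact Metric.mem_closedBall_self (by positivity)
  · rw [Metric.mem_closedBall, dist_comm]
    exact R.dist_small_adjacent e false
  · rw [Metric.mem_closedBall, dist_comm]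
    exact R.dist_small_adjacent e true

theorem disjoint_corners_of_clause_ne {e e' : φ.Incidence} (h : e.1 ≠ e'.1) :
    Disjoint (convexHull ℝ (R.corners e)) (convexHull ℝ (R.corners e')) :=
  disjoint_convexHull_of_closedBall (R.corners_subset_closedBall e)
    (R.corners_subset_closedBall e') (by linarith [R.dist_clausePos_lt h, R.η_pos'])

theorem cross_corners_ne_zero (e : φ.Incidence) :
    cross (R.place (.small e.1)) (R.place (.adjacent e false)) (R.place (.adjacent e true)) ≠
      0 := by
  obtain ⟨r, θ, h₁, h₂, h₃, h₄⟩ := R.place_adjacent e false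
  obtain ⟨r', θ', h₁', h₂', h₃', h₄'⟩ := R.place_adjacent e true
  rw [h₄, h₄', R.place_small, cross_polarPoint]
  have hs := sin_sub_ge_of_sideAngle h₃ h₃'
  have hη := R.η_pos'
  have hε := R.ε_pos'
  have hεη := R.ε_small'
  have hr : 0 < r * r' := mul_pos (by linarith) (by linarith)
  have h6 := mul_le_mul_of_nonneg_left hs hr.le
  have h7 : (99 / 100 * R.η) * (99 / 100 * R.η) ≤ r * r' :=
    mul_le_mul h₁ h₁' (by positivity) (by linarith)
  have h8 : r' * Real.sin θ' - r * Real.sin θ ≤ 2 * R.η := by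
    have a₁ := mul_le_mul_of_nonneg_left (Real.sin_le_one θ') (show 0 ≤ r' by linarith)
    have a₂ := mul_le_mul_of_nonneg_left (Real.neg_one_le_sin θ) (show 0 ≤ r by linarith)
    linarith
  have h9 := mul_le_mul_of_nonneg_left h8 hε.le
  have h10 : (R.ε : ℝ) * (2 * R.η) ≤ R.η / 200 * (2 * R.η) := by gcongr; linarith
  apply ne_of_gt
  nlinarith [sq_pos_of_pos hη]

theorem big_notMem_corners (e : φ.Incidence) (t : Fin φ.numClauses) :
    R.place (.big t) ∉ convexHull ℝ (R.corners e) := by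
  have hη := R.η_pos'
  rw [place_big]
  by_cases ht : e.1 = t
  · subst ht
    -- A functional that is positive on the corners, seen from the clause vertex.
    set s := R.slot e.1 e.2 with hs
    have hd := disjoint_convexHull_of_inner (s := {R.emb.clausePos e.1}) (t := R.corners e)
      (polarPoint 1 (sepAngle s)) (inner ℝ (polarPoint 1 (sepAngle s)) (R.emb.clausePos e.1))
      (by rintro x rfl; exact le_rfl) (by
        have key : ∀ b, inner ℝ (polarPoint 1 (sepAngle s)) (R.emb.clausePos e.1) <
            inner ℝ (polarPoint 1 (sepAngle s)) (R.place (.adjacent e b)) := by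
          intro b
          obtain ⟨r, θ, h₁, h₂, h₃, h₄⟩ := R.place_adjacent e b
          rw [h₄, inner_add_right, inner_polarPoint]
          have := cos_sub_sepAngle_pos h₃
          have : 0 < r := by linarith
          have : 0 < 1 * r * Real.cos (sepAngle s - θ) := by positivity
          linarith
        rintro x (rfl | rfl | rfl)
        · rw [place_small, inner_add_right, inner_polarPoint, sub_zero]
          have := cos_sepAngle_pos s
          have := R.ε_pos'
          have : 0 < 1 * (R.ε : ℝ) * Real.cos (sepAngle s) := by positivity
          linarith
        · exact key false
        · exact key true)
    exact fun h => Set.disjoint_left.1 hd (by simp) h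
  · intro h
    have := convexHull_min (R.corners_subset_closedBall e) (convex_closedBall _ _) h
    rw [Metric.mem_closedBall, dist_comm] at this
    linarith [R.dist_clausePos_lt ht]

theorem disjoint_adjacent_corners {e e' : φ.Incidence} (hne : e' ≠ e) :
    Disjoint (segment ℝ (R.place (.adjacent e' false)) (R.place (.adjacent e' true)))
      (convexHull ℝ (R.corners e)) := by
  have hη := R.η_pos'
  by_cases he : e'.1 = e.1
  · -- The direction of one of the towns beside `e'` separates.
    obtain ⟨r, θ, h₁, h₂, h₃, h₄⟩ := R.place_adjacent e' false
    have hs : R.slot e'.1 e'.2 ≠ R.slot e.1 e.2 := by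
      rw [← he]
      exact fun h => hne (Prod.ext he ((R.slot e'.1).injective h))
    rw [← convexHull_pair]
    refine (disjoint_convexHull_of_inner (polarPoint 1 θ)
      (inner ℝ (polarPoint 1 θ) (R.emb.clausePos e.1) + 21 / 100 * R.η) ?_ ?_).symm
    · have key : ∀ b, inner ℝ (polarPoint 1 θ) (R.place (.adjacent e b)) ≤
          inner ℝ (polarPoint 1 θ) (R.emb.clausePos e.1) + 21 / 100 * R.η := by
        intro b
        obtain ⟨r', θ', h₁', h₂', h₃', h₄'⟩ := R.place_adjacent e b
        rw [h₄', inner_add_right, inner_polarPoint]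
        have := cos_sub_le_of_sideAngle hs h₃ h₃'
        have h5 := mul_le_mul_of_nonneg_left this (show 0 ≤ r' by linarith)
        linarith
      rintro x (rfl | rfl | rfl)
      · rw [place_small, inner_add_right, inner_polarPoint]
        have := R.ε_pos'
        have h5 := mul_le_mul_of_nonneg_left (Real.cos_le_one (θ - 0)) this.le
        linarith [R.ε_small']
      · exact key false
      · exact key true
    · have key : ∀ b, inner ℝ (polarPoint 1 θ) (R.emb.clausePos e.1) + 21 / 100 * R.η <
          inner ℝ (polarPoint 1 θ) (R.place (.adjacent e' b)) := by
        intro b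
        obtain ⟨r', θ', h₁', h₂', h₃', h₄'⟩ := R.place_adjacent e' b
        rw [h₄', inner_add_right, inner_polarPoint, he]
        have := cos_sub_ge_of_sideAngle h₃ h₃'
        have h5 := mul_le_mul_of_nonneg_left this (show 0 ≤ r' by linarith)
        linarith
      rintro x (rfl | rfl)
      · exact key false
      · exact key true
  · rw [← convexHull_pair]
    refine (R.disjoint_corners_of_clause_ne he).mono_left (convexHull_mono ?_)
    exact Set.subset_insert _ _

/-- A segment from an edge town cannot meet the triangle of corners: it would cross one of its
sides, and again some three towns would be pairwise near. -/
theorem disjoint_edge_corners {e e' : φ.Incidence} {i : Fin (R.len e')} {b : φ.Town R.len}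
    (hb : b.IsOther) (hne : .edge e' i ≠ b) (hbe : ∀ s, b ≠ .adjacent e s)
    (dab : dist (R.place (.edge e' i)) (R.place b) ≤ R.η) :
    Disjoint (segment ℝ (R.place (.edge e' i)) (R.place b)) (convexHull ℝ (R.corners e)) := by
  have hη := R.η_pos'
  have hε := R.ε_pos'
  -- Edge towns are farther from the small clause town than any point of the triangle.
  have far : ∀ (e₁ : φ.Incidence) (j : Fin (R.len e₁)),
      R.η + R.ε < dist (R.place (.edge e₁ j)) (R.place (.small e.1)) := by
    intro e₁ j
    rw [dist_eq_norm]
    exact R.edge_isolated e₁ j _ (by simp) (chain_ne_small _ _ _).symm (chain_ne_small _ _ _).symm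
  rw [Set.disjoint_left]
  intro p hp hq
  have hout : R.place (.edge e' i) ∉ convexHull ℝ (R.corners e) := by
    intro h
    have := convexHull_min (R.corners_subset_closedBall_small e) (convex_closedBall _ _) h
    exact absurd (far e' i) (not_lt.2 this)
  have side : ∀ s, ∀ q ∈ segment ℝ (R.place (.edge e' i)) (R.place b),
      q ∉ segment ℝ (R.place (.small e.1)) (R.place (.adjacent e s)) := by
    intro s q hq₁ hq₂
    have k := dist_add_dist_le_of_mem_segments hq₁ hq₂
    have hw := R.dist_small_adjacent e s
    have nb : R.Near b (.adjacent e s) := R.near_of_dist_le (by linarith [far e' i])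
    cases b with
    | big => exact hb
    | small => exact hb
    | adjacent e'' s' =>
      obtain rfl := R.eq_of_near_adjacent nb
      exact hbe s' rfl
    | edge e'' j =>
      rw [segment_symm] at hq₁
      have k' := dist_add_dist_le_of_mem_segments hq₁ hq₂
      rw [dist_comm (R.place (.edge e'' j)) (R.place (.edge e' i))] at k'
      have na : R.Near (.edge e' i) (.adjacent e s) :=
        R.near_of_dist_le (by linarith [far e'' j])
      exact R.no_triangle_edge hne.symm (by simp) (by simp) (R.near_of_dist_le dab) na nb
  obtain ⟨q, hq₁, hq₂⟩ := exists_mem_side_of_mem_triangle (R.cross_corners_ne_zero e) hq hp hout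
  rcases hq₂ with hq₂ | hq₂ | hq₂
  · exact side _ q hq₁ hq₂
  · exact side _ q hq₁ hq₂
  · refine Set.disjoint_left.1 (R.disjoint_segment_segment (a := .edge e' i)
      (c := .adjacent e false) (d := .adjacent e true) trivial hb trivial trivial hne (by simp)
      (by simp) (by simp) (hbe false) (hbe true) dab ?_) hq₁ hq₂
    linarith [R.dist_adjacent_same e false true]

theorem disjoint_segment_corners {e : φ.Incidence} {a b : φ.Town R.len}
    (ha : a.IsOther) (hb : b.IsOther) (hab : a ≠ b) (hae : ∀ s, a ≠ .adjacent e s)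
    (hbe : ∀ s, b ≠ .adjacent e s) (dab : dist (R.place a) (R.place b) ≤ R.η) :
    Disjoint (segment ℝ (R.place a) (R.place b)) (convexHull ℝ (R.corners e)) := by
  cases a with
  | big => exact ha.elim
  | small => exact ha.elim
  | edge e' i => exact R.disjoint_edge_corners hb hab hbe dab
  | adjacent e' s =>
    cases b with
    | big => exact hb.elim
    | small => exact hb.elim
    | edge e'' i =>
      rw [segment_symm]
      rw [dist_comm] at dab
      exact R.disjoint_edge_corners ha hab.symm hae dab
    | adjacent e'' s' =>
      obtain rfl := R.eq_of_near_adjacent (R.near_of_dist_le dab)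
      have hne : e' ≠ e := fun h => hae s (by rw [h])
      have hd := R.disjoint_adjacent_corners hne
      cases s <;> cases s'
      · exact absurd rfl hab
      · exact hd
      · rwa [segment_symm]
      · exact absurd rfl hab

end Construction

end ThreeSAT

namespace ThreeSAT

/-! ### Counting voters -/

/-- The towns, sorted by kind. -/
def townEquiv (φ : ThreeSAT) (len : φ.Incidence → ℕ) :
    φ.Town len ≃ (Fin φ.numClauses ⊕ Fin φ.numClauses) ⊕
      ((φ.Incidence × Bool) ⊕ ((e : φ.Incidence) × Fin (len e))) where
  toFun
    | .big t => .inl (.inl t)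
    | .small t => .inl (.inr t)
    | .adjacent e s => .inr (.inl (e, s))
    | .edge e i => .inr (.inr ⟨e, i⟩)
  invFun
    | .inl (.inl t) => .big t
    | .inl (.inr t) => .small t
    | .inr (.inl (e, s)) => .adjacent e s
    | .inr (.inr ⟨e, i⟩) => .edge e i
  left_inv τ := by cases τ <;> rfl
  right_inv x := by rcases x with (t | t) | (⟨e, s⟩ | ⟨e, i⟩) <;> rfl

theorem sum_town {φ : ThreeSAT} {len : φ.Incidence → ℕ} {M : Type*} [AddCommMonoid M]
    (f : φ.Town len → M) :
    ∑ τ, f τ = (∑ t, f (.big t)) + (∑ t, f (.small t)) + ((∑ e, ∑ s, f (.adjacent e s)) +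
      ∑ e, ∑ i, f (.edge e i)) := by
  rw [← (townEquiv φ len).symm.sum_comp, Fintype.sum_sum_type, Fintype.sum_sum_type,
    Fintype.sum_sum_type, Fintype.sum_prod_type, Fintype.sum_sigma]
  rfl

instance {φ : ThreeSAT} {len : φ.Incidence → ℕ} :
    DecidablePred (Town.IsOther : φ.Town len → Prop) := by
  intro τ
  cases τ <;> simp only [Town.IsOther] <;> infer_instance

namespace Construction

variable {φ : ThreeSAT} {γ : ℚ} (R : φ.Construction γ)

/-- The voters behind their numbers. -/
noncomputable def voterEquiv (d : ℚ) : Fin (R.toInstance d).n ≃ R.Voter :=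
  (Fintype.equivFin R.Voter).symm

/-- The town of a voter. -/
noncomputable def town (d : ℚ) (i : Fin (R.toInstance d).n) : φ.Town R.len :=
  (R.voterEquiv d i).1

theorem pref_eq_one_iff (d : ℚ) (i : Fin (R.toInstance d).n) :
    (R.toInstance d).pref i = 1 ↔ ∃ a, Sum.inl a = (R.voterEquiv d i).2 := by
  change Sum.elim (fun _ => (1 : Fin 2)) (fun _ => 0) (R.voterEquiv d i).2 = 1 ↔ _
  generalize (R.voterEquiv d i).2 = x
  rcases x with x | x <;> simp

/-- The number of voters in a town. -/
def size (τ : φ.Town R.len) : ℕ := R.ones τ + R.zeros τ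

theorem card_filter_town (d : ℚ) (S : Finset (φ.Town R.len)) :
    (Finset.univ.filter fun i : Fin (R.toInstance d).n => R.town d i ∈ S).card =
      ∑ τ ∈ S, R.size τ := by
  have h : (Finset.univ.filter fun i : Fin (R.toInstance d).n => R.town d i ∈ S).card =
      (S.sigma fun τ => (Finset.univ : Finset (Fin (R.ones τ) ⊕ Fin (R.zeros τ)))).card := by
    refine Finset.card_equiv (R.voterEquiv d) fun i => ?_
    rw [Finset.mem_filter]
    simp [town]
  rw [h, Finset.card_sigma]
  simp [size]

theorem card_filter_town_pref (d : ℚ) (S : Finset (φ.Town R.len)) :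
    ((Finset.univ.filter fun i : Fin (R.toInstance d).n => R.town d i ∈ S).filter
      fun i => (R.toInstance d).pref i = 1).card = ∑ τ ∈ S, R.ones τ := by
  have h : ((Finset.univ.filter fun i : Fin (R.toInstance d).n => R.town d i ∈ S).filter
      fun i => (R.toInstance d).pref i = 1).card =
      (S.sigma fun τ => (Finset.univ : Finset (Fin (R.ones τ))).map
        (Function.Embedding.inl (β := Fin (R.zeros τ)))).card := by
    refine Finset.card_equiv (R.voterEquiv d) fun i => ?_
    rw [Finset.mem_filter, Finset.mem_filter]
    simp [town, pref_eq_one_iff]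
  rw [h, Finset.card_sigma]
  simp

theorem sum_size_eq_n (d : ℚ) : ∑ τ, R.size τ = (R.toInstance d).n := by
  rw [← R.card_filter_town d Finset.univ]
  simp

theorem card_filter_isOther :
    (Finset.univ.filter fun τ : φ.Town R.len => τ.IsOther).card = R.numOther := by
  rw [Finset.card_filter, sum_town]
  simp [Town.IsOther, numOther]
  ring

/-- Around a variable, signs change an even number of times. -/
theorem even_sum_len : Even (∑ e, R.len e) := by
  rw [← ZMod.natCast_eq_zero_iff_even, Nat.cast_sum]
  have h : ∀ e, (R.len e : ZMod 2) =
      (if φ.incSign e then 1 else 0) + (if φ.incSign (R.next e) then 1 else 0) := by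
    intro e
    have hp := R.len_parity e
    by_cases hev : Even (R.len e)
    · rw [(ZMod.natCast_eq_zero_iff_even).2 hev, ← hp.1 hev]
      cases φ.incSign e <;> decide
    · rw [(ZMod.natCast_eq_one_iff_odd).2 (Nat.not_even_iff_odd.1 hev)]
      have := fun h => hev (hp.2 h)
      revert this
      cases φ.incSign e <;> cases φ.incSign (R.next e) <;> simp
  rw [Finset.sum_congr rfl fun e _ => h e, Finset.sum_add_distrib,
    Equiv.sum_comp R.next fun e => if φ.incSign e then (1 : ZMod 2) else 0]
  exact CharTwo.add_self_eq_zero _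

theorem two_mul_k (d : ℚ) :
    2 * ((R.toInstance d).k : ℚ) = 8 * φ.numClauses + ∑ e, (R.len e : ℚ) := by
  obtain ⟨m, hm⟩ := R.even_sum_len
  have h : 2 * (R.toInstance d).k = 8 * φ.numClauses + ∑ e, R.len e := by
    simp only [toInstance, numOther]
    omega
  exact_mod_cast h

theorem numClauses_le_k (d : ℚ) : 4 * (φ.numClauses : ℚ) ≤ (R.toInstance d).k := by
  have h := R.two_mul_k d
  have : (0 : ℚ) ≤ ∑ e, (R.len e : ℚ) := Finset.sum_nonneg fun _ _ => by positivity
  linarith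

theorem floor_edge_le {q : ℕ} (hq : R.L = 4 * q) (hγ : γ ≤ 1 / 3) :
    ⌊γ / 4 * (R.L : ℚ)⌋₊ ≤ q := by
  apply Nat.floor_le_of_le
  rw [hq]
  push_cast
  nlinarith [(Nat.cast_nonneg q : (0 : ℚ) ≤ q)]

theorem size_edge (hγ : γ ≤ 1 / 3) (e : φ.Incidence) (i : Fin (R.len e)) :
    2 * R.size (.edge e i) = R.L := by
  obtain ⟨q, hq⟩ := R.L_dvd
  have := R.floor_edge_le hq hγ
  simp only [size, ones, zeros]
  rw [show R.L / 4 = q by omega]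
  omega

theorem size_adjacent (e : φ.Incidence) (s : Bool) :
    2 * R.size (.adjacent e s) = R.L + 2 * ⌊γ / 6 * (R.L : ℚ)⌋₊ := by
  obtain ⟨q, hq⟩ := R.L_dvd
  simp only [size, ones, zeros]
  omega

theorem size_big (t : Fin φ.numClauses) : R.size (.big t) = R.L := by
  simp [size, ones, zeros]

theorem size_small (t : Fin φ.numClauses) :
    R.size (.small t) = ⌊2 * γ / 3 * (R.L : ℚ)⌋₊ := by
  simp [size, ones, zeros]

/-- The excess of the voters over `L` per district comes from the small clause towns and the
clause-adjacent towns. -/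
theorem n_eq (hγ : γ ≤ 1 / 3) (d : ℚ) :
    ((R.toInstance d).n : ℚ) = R.L * (R.toInstance d).k + φ.numClauses *
      ((⌊2 * γ / 3 * (R.L : ℚ)⌋₊ : ℚ) + 6 * (⌊γ / 6 * (R.L : ℚ)⌋₊ : ℚ)) := by
  have h₁ : ∀ e i, (R.size (.edge e i) : ℚ) = R.L / 2 := by
    intro e i
    have : (2 : ℚ) * R.size (.edge e i) = R.L := by exact_mod_cast R.size_edge hγ e i
    linarith
  have h₂ : ∀ e s, (R.size (.adjacent e s) : ℚ) = R.L / 2 + (⌊γ / 6 * (R.L : ℚ)⌋₊ : ℚ) := by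
    intro e s
    have : (2 : ℚ) * R.size (.adjacent e s) = R.L + 2 * (⌊γ / 6 * (R.L : ℚ)⌋₊ : ℚ) := by
      exact_mod_cast R.size_adjacent e s
    linarith
  rw [← R.sum_size_eq_n, Nat.cast_sum, sum_town]
  simp only [h₁, h₂, size_big, size_small, Finset.sum_const, Finset.card_univ, Fintype.card_fin,
    Fintype.card_bool, Fintype.card_prod, nsmul_eq_mul, ← Finset.sum_mul]
  have hk := R.two_mul_k d
  push_cast
  linear_combination (-(R.L : ℚ) / 2) * hk

theorem L_pos (hγ0 : 0 < γ) : (0 : ℚ) < R.L :=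
  lt_trans (by positivity) R.L_large

theorem three_le_mul_L (hγ0 : 0 < γ) (hγ : γ ≤ 1 / 3) : 3 ≤ γ * R.L := by
  have h := R.L_large
  rw [div_lt_iff₀ (by positivity)] at h
  nlinarith

theorem floor_small_le (hγ0 : 0 < γ) : (⌊2 * γ / 3 * (R.L : ℚ)⌋₊ : ℚ) ≤ 2 * γ / 3 * R.L :=
  Nat.floor_le (by positivity)

theorem floor_adjacent_le (hγ0 : 0 < γ) : (⌊γ / 6 * (R.L : ℚ)⌋₊ : ℚ) ≤ γ / 6 * R.L :=
  Nat.floor_le (by positivity)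

/-- The small clause town outweighs the majorities of preference `0` in two clause-adjacent
towns. -/
theorem two_mul_floor_adjacent_lt (hγ0 : 0 < γ) (hγ : γ ≤ 1 / 3) :
    2 * ⌊γ / 6 * (R.L : ℚ)⌋₊ < ⌊2 * γ / 3 * (R.L : ℚ)⌋₊ := by
  have h₁ := R.floor_adjacent_le hγ0
  have h₂ := Nat.lt_floor_add_one (2 * γ / 3 * (R.L : ℚ))
  have h₃ := R.three_le_mul_L hγ0 hγ
  have : (2 * ⌊γ / 6 * (R.L : ℚ)⌋₊ : ℚ) < ⌊2 * γ / 3 * (R.L : ℚ)⌋₊ := by linarith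
  exact_mod_cast this

theorem size_pos (hγ0 : 0 < γ) (hγ : γ ≤ 1 / 3) (τ : φ.Town R.len) : 0 < R.size τ := by
  have hL : 0 < R.L := by exact_mod_cast R.L_pos hγ0
  cases τ with
  | big t => rwa [size_big]
  | small t =>
    rw [size_small]
    exact (Nat.zero_le _).trans_lt (R.two_mul_floor_adjacent_lt hγ0 hγ)
  | adjacent e s =>
    have := R.size_adjacent e s
    omega
  | edge e i =>
    have := R.size_edge hγ e i
    omega

/-- A town that is not a clause town does not have a majority of preference `1`. -/
theorem two_mul_ones_le {τ : φ.Town R.len} (h : τ.IsOther) : 2 * R.ones τ ≤ R.size τ := by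
  cases τ with
  | big => exact h.elim
  | small => exact h.elim
  | adjacent e s =>
    simp only [size, ones, zeros]
    omega
  | edge e i =>
    simp only [size, ones, zeros]
    omega

theorem L_mul_k_le_n (hγ : γ ≤ 1 / 3) (d : ℚ) :
    (R.L : ℚ) * (R.toInstance d).k ≤ (R.toInstance d).n := by
  rw [R.n_eq hγ]
  have : (0 : ℚ) ≤ φ.numClauses *
      ((⌊2 * γ / 3 * (R.L : ℚ)⌋₊ : ℚ) + 6 * (⌊γ / 6 * (R.L : ℚ)⌋₊ : ℚ)) := by positivity
  linarith

/-- The average district size exceeds `L` by at most a quarter of the excess at one clause. -/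
theorem average_le (hγ : γ ≤ 1 / 3) (d : ℚ) (hk : 0 < (R.toInstance d).k) :
    ((R.toInstance d).n : ℚ) / (R.toInstance d).k ≤
      R.L + ((⌊2 * γ / 3 * (R.L : ℚ)⌋₊ : ℚ) + 6 * (⌊γ / 6 * (R.L : ℚ)⌋₊ : ℚ)) / 4 := by
  have hk' : (0 : ℚ) < (R.toInstance d).k := by exact_mod_cast hk
  rw [div_le_iff₀ hk', R.n_eq hγ]
  have h := R.numClauses_le_k d
  have h₀ : (0 : ℚ) ≤ (⌊2 * γ / 3 * (R.L : ℚ)⌋₊ : ℚ) + 6 * (⌊γ / 6 * (R.L : ℚ)⌋₊ : ℚ) := by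
    positivity
  nlinarith

theorem le_average (hγ : γ ≤ 1 / 3) (d : ℚ) (hk : 0 < (R.toInstance d).k) :
    (R.L : ℚ) ≤ ((R.toInstance d).n : ℚ) / (R.toInstance d).k := by
  rw [le_div_iff₀ (by exact_mod_cast hk)]
  exact R.L_mul_k_le_n hγ d

/-- The sizes of districts that satisfy (F1) include those from `L` to `(1 + γ) L`. -/
theorem size_bounds (hγ0 : 0 < γ) (hγ : γ ≤ 1 / 3) (d : ℚ) (hk : 0 < (R.toInstance d).k) {s : ℚ}
    (h₁ : (R.L : ℚ) ≤ s) (h₂ : s ≤ (1 + γ) * R.L) :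
    (1 - γ) * (((R.toInstance d).n : ℚ) / (R.toInstance d).k) ≤ s ∧
      s ≤ (1 + γ) * (((R.toInstance d).n : ℚ) / (R.toInstance d).k) := by
  have a₁ := R.average_le hγ d hk
  have a₂ := R.le_average hγ d hk
  have b₁ := R.floor_small_le hγ0
  have b₂ := R.floor_adjacent_le hγ0
  have hL := R.L_pos hγ0
  refine ⟨?_, h₂.trans (mul_le_mul_of_nonneg_left a₂ (by linarith))⟩
  refine (mul_le_mul_of_nonneg_left a₁ (by linarith)).trans (le_trans ?_ h₁)
  have : (⌊2 * γ / 3 * (R.L : ℚ)⌋₊ : ℚ) + 6 * (⌊γ / 6 * (R.L : ℚ)⌋₊ : ℚ) ≤ 5 * γ / 3 * R.L := by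
    linarith
  calc (1 - γ) * (R.L + ((⌊2 * γ / 3 * (R.L : ℚ)⌋₊ : ℚ) + 6 * (⌊γ / 6 * (R.L : ℚ)⌋₊ : ℚ)) / 4)
      ≤ (1 - γ) * (R.L + (5 * γ / 3 * R.L) / 4) := by
        gcongr
        linarith
    _ ≤ R.L := by nlinarith [mul_pos hγ0 hL, mul_pos hγ0 (mul_pos hγ0 hL)]

/-- A big clause town and a clause-adjacent town together are too large for a district. -/
theorem upper_lt_size_big_add_adjacent (hγ0 : 0 < γ) (hγ : γ ≤ 1 / 3) (d : ℚ)
    (hk : 0 < (R.toInstance d).k) (t : Fin φ.numClauses) (e : φ.Incidence) (s : Bool) :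
    (1 + γ) * (((R.toInstance d).n : ℚ) / (R.toInstance d).k) <
      R.size (.big t) + R.size (.adjacent e s) := by
  have a₁ := R.average_le hγ d hk
  have b₁ := R.floor_small_le hγ0
  have b₂ := R.floor_adjacent_le hγ0
  have hL := R.L_pos hγ0
  have h₂ : (2 : ℚ) * R.size (.adjacent e s) = R.L + 2 * (⌊γ / 6 * (R.L : ℚ)⌋₊ : ℚ) := by
    exact_mod_cast R.size_adjacent e s
  rw [size_big]
  refine (mul_le_mul_of_nonneg_left a₁ (by linarith)).trans_lt ?_
  generalize (⌊2 * γ / 3 * (R.L : ℚ)⌋₊ : ℚ) = x at *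
  generalize (⌊γ / 6 * (R.L : ℚ)⌋₊ : ℚ) = a at *
  generalize (R.L : ℚ) = l at *
  -- The difference is least for the largest `x` and `a`, and then decreases in `γ` up to `1 / 3`.
  have k₁ : (1 + γ) * x ≤ (1 + γ) * (2 * γ / 3 * l) :=
    mul_le_mul_of_nonneg_left b₁ (by linarith)
  have k₂ : (3 / 2 * (1 + γ) - 1) * a ≤ (3 / 2 * (1 + γ) - 1) * (γ / 6 * l) :=
    mul_le_mul_of_nonneg_left b₂ (by linarith)
  have k₃ : γ * l ≤ 1 / 3 * l := mul_le_mul_of_nonneg_right hγ hL.le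
  have k₄ : γ * (γ * l) ≤ 1 / 3 * (1 / 3 * l) := mul_le_mul hγ k₃ (by positivity) (by norm_num)
  linarith

/-! ### Rescaling -/

theorem toPlane_loc (d : ℚ) (i : Fin (R.toInstance d).n) :
    toPlane ((R.toInstance d).loc i) = ((d : ℝ) / (R.η + R.ε)) • R.place (R.town d i) := by
  have h : (R.toInstance d).loc i = (d / (R.η + R.ε) * (R.pos (R.town d i)).1,
      d / (R.η + R.ε) * (R.pos (R.town d i)).2) := rfl
  rw [h]
  ext j
  fin_cases j <;> simp [toPlane, place]

theorem norm_loc_sub_le_iff {d : ℚ} (hd : 0 < d) (i j : Fin (R.toInstance d).n) :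
    ‖toPlane ((R.toInstance d).loc i) - toPlane ((R.toInstance d).loc j)‖ ≤ (d : ℝ) ↔
      R.Near (R.town d i) (R.town d j) := by
  have hd' : (0 : ℝ) < d := by exact_mod_cast hd
  have hs : (0 : ℝ) < R.η + R.ε := add_pos R.η_pos' R.ε_pos'
  rw [toPlane_loc, toPlane_loc, ← smul_sub, norm_smul, Real.norm_of_nonneg (by positivity),
    ← dist_eq_norm, Near, div_mul_eq_mul_div, div_le_iff₀ hs, mul_le_mul_iff_right₀ hd']

open scoped Pointwise in
theorem hull_subset (d : ℚ) {D : Finset (Fin (R.toInstance d).n)} {S : Set (φ.Town R.len)}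
    (h : ∀ i ∈ D, R.town d i ∈ S) :
    (R.toInstance d).hull D ⊆ ((d : ℝ) / (R.η + R.ε)) • convexHull ℝ (R.place '' S) := by
  rw [← convexHull_smul]
  apply convexHull_mono
  rintro _ ⟨i, hi, rfl⟩
  simp only [toPlane_loc]
  exact Set.smul_mem_smul_set ⟨_, h i hi, rfl⟩

open scoped Pointwise in
theorem hull_inter_eq_empty {d : ℚ} (hd : 0 < d) {D D' : Finset (Fin (R.toInstance d).n)}
    {S S' : Set (φ.Town R.len)} (h : ∀ i ∈ D, R.town d i ∈ S) (h' : ∀ i ∈ D', R.town d i ∈ S')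
    (hdisj : Disjoint (convexHull ℝ (R.place '' S)) (convexHull ℝ (R.place '' S'))) :
    (R.toInstance d).hull D ∩ (R.toInstance d).hull D' = ∅ := by
  have hd' : (0 : ℝ) < d := by exact_mod_cast hd
  have hs : (0 : ℝ) < R.η + R.ε := add_pos R.η_pos' R.ε_pos'
  rw [← Set.disjoint_iff_inter_eq_empty]
  refine Disjoint.mono (R.hull_subset d h) (R.hull_subset d h') ?_
  rw [Set.disjoint_iff_inter_eq_empty, ← Set.smul_set_inter₀ (by positivity),
    Set.disjoint_iff_inter_eq_empty.1 hdisj, Set.smul_set_empty]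

end Construction

end ThreeSAT

namespace ThreeSAT

namespace Construction

variable {φ : ThreeSAT} {γ : ℚ} (R : φ.Construction γ)

/-! ### From a redistricting to an assignment -/

section Matching

variable {k : ℕ} {f : φ.Town R.len → Fin k}

/-- Counting districts: the towns that share a district with a big clause town are small clause
towns, so the remaining districts have to pair up all towns that are not clause towns. -/
theorem exists_partner (hk : k = φ.numClauses + R.numOther / 2)
    (hnear : ∀ τ σ, f τ = f σ → R.Near τ σ) (hbig : ∀ t e s, f (.big t) ≠ f (.adjacent e s)) :
    (∀ τ : φ.Town R.len, τ.IsOther → ∃ σ : φ.Town R.len, σ.IsOther ∧ σ ≠ τ ∧ f σ = f τ) ∧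
      ∀ l, (∀ t, f (.big t) ≠ l) →
        ∃ τ σ : φ.Town R.len, τ.IsOther ∧ σ.IsOther ∧ τ ≠ σ ∧ f τ = l ∧ f σ = l := by
  classical
  set O : Finset (φ.Town R.len) := Finset.univ.filter fun τ => τ.IsOther with hO
  set B : Finset (Fin k) := Finset.univ.image fun t => f (.big t) with hB
  have hBcard : B.card = φ.numClauses := by
    rw [hB, Finset.card_image_of_injective, Finset.card_univ, Fintype.card_fin]
    intro t t' h
    rcases R.near_big_or_small (Or.inl rfl) (hnear _ _ h) with h' | h' | ⟨e, b, -, h'⟩ <;>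
      cases h'
    rfl
  have hle : ∀ l, (O.filter fun τ => f τ = l).card ≤ 2 := by
    intro l
    by_contra! hlt
    obtain ⟨a, ha, b, hb, c, hc, hab, hac, hbc⟩ := Finset.two_lt_card.1 hlt
    simp only [hO, Finset.mem_filter, Finset.mem_univ, true_and] at ha hb hc
    exact R.no_triangle ha.1 hb.1 hc.1 hab hac hbc (hnear _ _ (ha.2.trans hb.2.symm))
      (hnear _ _ (ha.2.trans hc.2.symm)) (hnear _ _ (hb.2.trans hc.2.symm))
  have hzero : ∀ t, ∀ τ : φ.Town R.len, τ.IsOther → f (.big t) ≠ f τ := by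
    intro t τ hτ h
    rcases R.near_big_or_small (Or.inl rfl) (hnear _ _ h) with rfl | rfl | ⟨e, b, -, rfl⟩
    · exact hτ
    · exact hτ
    · exact hbig _ _ _ h
  have hsum : R.numOther = ∑ l ∈ Bᶜ, (O.filter fun τ => f τ = l).card := by
    rw [← R.card_filter_isOther, ← hO]
    refine Finset.card_eq_sum_card_fiberwise fun τ hτ => ?_
    simp only [hO, Finset.coe_filter, Finset.mem_univ, true_and, Set.mem_ofPred_eq] at hτ
    simp only [hB, Finset.coe_compl, Finset.coe_image, Finset.coe_univ, Set.image_univ,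
      Set.mem_compl_iff, Set.mem_range, not_exists]
    exact fun t => hzero t τ hτ
  have hcompl : (Bᶜ).card = R.numOther / 2 := by
    rw [Finset.card_compl, hBcard, Fintype.card_fin, hk]
    omega
  -- At most `numOther / 2` districts hold `numOther` towns, at most two each.
  have htwo : ∀ l ∈ Bᶜ, (O.filter fun τ => f τ = l).card = 2 := by
    intro l hl
    by_contra hne
    have hlt : ∑ l ∈ Bᶜ, (O.filter fun τ => f τ = l).card < ∑ l ∈ Bᶜ, 2 :=
      Finset.sum_lt_sum (fun l _ => hle l) ⟨l, hl, lt_of_le_of_ne (hle l) hne⟩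
    rw [← hsum, Finset.sum_const, hcompl, smul_eq_mul] at hlt
    omega
  have hpair : ∀ l, (∀ t, f (.big t) ≠ l) →
      ∃ τ σ : φ.Town R.len, τ.IsOther ∧ σ.IsOther ∧ τ ≠ σ ∧ f τ = l ∧ f σ = l := by
    intro l hl
    obtain ⟨a, b, hab, h⟩ := Finset.card_eq_two.1 (htwo l (by simpa [hB] using hl))
    have ha : a ∈ O.filter fun τ => f τ = l := by simp [h]
    have hb : b ∈ O.filter fun τ => f τ = l := by simp [h]
    simp only [hO, Finset.mem_filter, Finset.mem_univ, true_and] at ha hb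
    exact ⟨a, b, ha.1, hb.1, hab, ha.2, hb.2⟩
  refine ⟨fun τ hτ => ?_, hpair⟩
  obtain ⟨a, b, ha, hb, hab, fa, fb⟩ := hpair (f τ) fun t => hzero t τ hτ
  by_cases h : a = τ
  · exact ⟨b, hb, fun h' => hab (h.trans h'.symm), fb⟩
  · exact ⟨a, ha, h, fa⟩

/-- A town with only two neighbours is paired with exactly one of them. -/
theorem partner_unique (hnear : ∀ τ σ, f τ = f σ → R.Near τ σ)
    (hpartner : ∀ τ : φ.Town R.len, τ.IsOther →
      ∃ σ : φ.Town R.len, σ.IsOther ∧ σ ≠ τ ∧ f σ = f τ)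
    {τ a b : φ.Town R.len} (hτ : τ.IsOther) (ha : a.IsOther) (hb : b.IsOther)
    (hτa : τ ≠ a) (hτb : τ ≠ b) (hab : a ≠ b)
    (h : ∀ σ : φ.Town R.len, σ.IsOther → σ ≠ τ → R.Near σ τ → σ = a ∨ σ = b) :
    f τ = f a ↔ ¬ f τ = f b := by
  constructor
  · intro h₁ h₂
    exact R.no_triangle hτ ha hb hτa hτb hab (hnear _ _ h₁) (hnear _ _ h₂)
      (hnear _ _ (h₁.symm.trans h₂))
  · intro h₂
    obtain ⟨σ, hσ, hne, hf⟩ := hpartner τ hτ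
    rcases h σ hσ hne (hnear _ _ hf) with rfl | rfl
    · exact hf.symm
    · exact absurd hf.symm h₂

theorem start_paired_iff (hnear : ∀ τ σ, f τ = f σ → R.Near τ σ)
    (hpartner : ∀ τ : φ.Town R.len, τ.IsOther →
      ∃ σ : φ.Town R.len, σ.IsOther ∧ σ ≠ τ ∧ f σ = f τ)
    (e : φ.Incidence) :
    f (φ.chain R.len R.next e 0) = f (φ.chain R.len R.next e 1) ↔
      ¬ f (.adjacent e false) = f (.adjacent e true) := by
  have hl := R.len_pos e
  rw [chain_succ_of_lt hl]
  refine R.partner_unique hnear hpartner trivial trivial trivial (by simp [chain])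
    (by simp [chain]) (by simp) fun σ hσ hne hn => ?_
  change R.Near σ (.adjacent e false) at hn
  cases σ with
  | big => exact hσ.elim
  | small => exact hσ.elim
  | adjacent e' s =>
    obtain rfl := R.eq_of_near_adjacent hn
    cases s
    · exact absurd rfl hne
    · exact Or.inr rfl
  | edge e' i =>
    rcases R.near_edge hn (by simp) with h | h
    · obtain ⟨rfl, h'⟩ := chain_eq_adjacent_false_iff.1 h.symm
      exact Or.inl (by congr 1; exact Fin.ext h')
    · exact absurd (chain_eq_adjacent_false_iff.1 h.symm).2 (by simp)

theorem end_paired_iff (hnear : ∀ τ σ, f τ = f σ → R.Near τ σ)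
    (hpartner : ∀ τ : φ.Town R.len, τ.IsOther →
      ∃ σ : φ.Town R.len, σ.IsOther ∧ σ ≠ τ ∧ f σ = f τ)
    (e : φ.Incidence) :
    f (φ.chain R.len R.next e (R.len e)) = f (φ.chain R.len R.next e (R.len e + 1)) ↔
      ¬ f (.adjacent (R.next e) false) = f (.adjacent (R.next e) true) := by
  have hl := R.len_pos e
  obtain ⟨m, hm⟩ : ∃ m, R.len e = m + 1 := ⟨R.len e - 1, by omega⟩
  rw [chain_succ_of_le le_rfl, eq_comm, eq_comm (a := f (.adjacent _ false))]
  refine R.partner_unique hnear hpartner trivial (isOther_chain _ _) trivial ?_ (by simp) ?_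
    fun σ hσ hne hn => ?_
  · rw [hm, chain_succ_of_lt (by omega)]
    simp
  · rw [hm, chain_succ_of_lt (by omega)]
    simp
  cases σ with
  | big => exact hσ.elim
  | small => exact hσ.elim
  | adjacent e' s =>
    obtain rfl := R.eq_of_near_adjacent hn
    cases s
    · exact Or.inr rfl
    · exact absurd rfl hne
  | edge e' i =>
    have hi := i.2
    rcases R.near_edge hn (by simp) with h | h
    · have := (chain_eq_adjacent_true_iff.1 h.symm).2
      omega
    · obtain ⟨h', h''⟩ := chain_eq_adjacent_true_iff.1 h.symm
      obtain rfl := R.next.injective h'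
      exact Or.inl (chain_eq_edge_iff.2 ⟨rfl, by omega⟩).symm

/-- Along a chain, paired and unpaired steps alternate. -/
theorem step_paired_iff (hnear : ∀ τ σ, f τ = f σ → R.Near τ σ)
    (hpartner : ∀ τ : φ.Town R.len, τ.IsOther →
      ∃ σ : φ.Town R.len, σ.IsOther ∧ σ ≠ τ ∧ f σ = f τ)
    (e : φ.Incidence) (p : ℕ) (hp : p ≤ R.len e) :
    f (φ.chain R.len R.next e p) = f (φ.chain R.len R.next e (p + 1)) ↔
      (f (.adjacent e false) = f (.adjacent e true) ↔ Odd p) := by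
  induction p with
  | zero => simpa using R.start_paired_iff hnear hpartner e
  | succ p ih =>
    have hlt : p < R.len e := by omega
    have h : f (φ.chain R.len R.next e (p + 1)) = f (φ.chain R.len R.next e (p + 2)) ↔
        ¬ f (φ.chain R.len R.next e (p + 1)) = f (φ.chain R.len R.next e p) := by
      refine R.partner_unique hnear hpartner (isOther_chain _ _) (isOther_chain _ _)
        (isOther_chain _ _) ?_ ?_ ?_ fun σ hσ hne hn => ?_
      · exact fun h => by have := chain_injOn (by omega) (by omega) h; omega
      · exact fun h => by have := chain_injOn (by omega) (by omega) h; omega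
      · exact fun h => by have := chain_injOn (by omega) (by omega) h; omega
      · rw [chain_succ_of_lt hlt] at hne hn
        exact (R.near_edge hn.symm hne).symm
    rw [h, eq_comm (a := f (φ.chain R.len R.next e (p + 1))), ih (by omega), Nat.odd_add_one]
    tauto

/-- Whether the two towns beside an edge are paired, compared with the sign of the edge, does not
change from an edge to the next edge of the same variable. -/
theorem paired_iff_sign_next (hnear : ∀ τ σ, f τ = f σ → R.Near τ σ)
    (hpartner : ∀ τ : φ.Town R.len, τ.IsOther →
      ∃ σ : φ.Town R.len, σ.IsOther ∧ σ ≠ τ ∧ f σ = f τ)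
    (e : φ.Incidence) :
    (f (.adjacent e false) = f (.adjacent e true) ↔ φ.incSign e = true) ↔
      (f (.adjacent (R.next e) false) = f (.adjacent (R.next e) true) ↔
        φ.incSign (R.next e) = true) := by
  have h := (R.end_paired_iff hnear hpartner e).symm.trans
    (R.step_paired_iff hnear hpartner e _ le_rfl)
  have hp := R.len_parity e
  rw [← Nat.not_even_iff_odd, hp] at h
  revert h
  cases φ.incSign e <;> cases φ.incSign (R.next e) <;> simp <;> tauto

theorem paired_iff_sign (hnear : ∀ τ σ, f τ = f σ → R.Near τ σ)
    (hpartner : ∀ τ : φ.Town R.len, τ.IsOther →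
      ∃ σ : φ.Town R.len, σ.IsOther ∧ σ ≠ τ ∧ f σ = f τ)
    {e e' : φ.Incidence} (h : φ.incVar e = φ.incVar e') :
    (f (.adjacent e false) = f (.adjacent e true) ↔ φ.incSign e = true) ↔
      (f (.adjacent e' false) = f (.adjacent e' true) ↔ φ.incSign e' = true) := by
  obtain ⟨n, -, rfl⟩ := ((R.next_spec e e').2 h).exists_pow_eq'
  clear h
  induction n with
  | zero => rfl
  | succ n ih =>
    rw [ih, pow_succ', Equiv.Perm.mul_apply]
    exact R.paired_iff_sign_next hnear hpartner _

end Matching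

/-- A map of towns to districts that is legal and fair yields a satisfying assignment: a variable
is true if the pairs of towns beside its edges are formed where its sign is positive. -/
theorem satisfiable_of_districtMap {k : ℕ} {f : φ.Town R.len → Fin k}
    (hk : k = φ.numClauses + R.numOther / 2)
    (hnear : ∀ τ σ, f τ = f σ → R.Near τ σ) (hbig : ∀ t e s, f (.big t) ≠ f (.adjacent e s))
    (hfair : 2 * φ.numClauses ≤ (Finset.univ.filter fun l : Fin k =>
      ∑ τ with f τ = l, R.size τ < 2 * ∑ τ with f τ = l, R.ones τ).card) :
    φ.Satisfiable := by
  classical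
  obtain ⟨hpartner, hpair⟩ := R.exists_partner hk hnear hbig
  set B : Finset (Fin k) := Finset.univ.image fun t => f (.big t) with hB
  set S : Finset (Fin k) := Finset.univ.image fun t => f (.small t) with hS
  -- A district with a majority of preference `1` contains a clause town.
  have hsub : (Finset.univ.filter fun l : Fin k =>
      ∑ τ with f τ = l, R.size τ < 2 * ∑ τ with f τ = l, R.ones τ) ⊆ B ∪ S := by
    intro l hl
    by_contra hn
    simp only [hB, hS, Finset.mem_union, Finset.mem_image, Finset.mem_univ, true_and,
      not_or, not_exists] at hn
    rw [Finset.mem_filter] at hl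
    refine absurd hl.2 (not_lt.2 ?_)
    rw [Finset.mul_sum]
    refine Finset.sum_le_sum fun τ hτ => R.two_mul_ones_le ?_
    have hτ' : f τ = l := by simpa using hτ
    cases τ with
    | big t => exact absurd hτ' (hn.1 t)
    | small t => exact absurd hτ' (hn.2 t)
    | adjacent => trivial
    | edge => trivial
  -- There are at most `numClauses` districts of either kind, and twice that many are required.
  have hBS : Disjoint B S := by
    rw [← Finset.card_union_eq_card_add_card]
    have h₁ : B.card ≤ φ.numClauses := Finset.card_image_le.trans (by simp)
    have h₂ : S.card ≤ φ.numClauses := Finset.card_image_le.trans (by simp)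
    have h₃ := Finset.card_union_le B S
    have h₄ := hfair.trans (Finset.card_le_card hsub)
    omega
  have hon : ∀ t, ∃ j, f (.adjacent (t, j) false) = f (.adjacent (t, j) true) := by
    intro t
    obtain ⟨a, b, ha, hb, hab, fa, fb⟩ := hpair (f (.small t)) fun t' h =>
      Finset.disjoint_left.1 hBS (by simp [hB] : f (.big t') ∈ B) (by simp [hS, h])
    rcases R.near_big_or_small (Or.inr rfl) (hnear _ _ fa.symm) with
      rfl | rfl | ⟨⟨t₁, j₁⟩, s₁, rfl, rfl⟩
    · exact ha.elim
    · exact ha.elim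
    rcases R.near_big_or_small (Or.inr rfl) (hnear _ _ fb.symm) with rfl | rfl | ⟨e₂, s₂, -, rfl⟩
    · exact hb.elim
    · exact hb.elim
    obtain rfl := R.eq_of_near_adjacent (hnear _ _ (fa.trans fb.symm))
    refine ⟨j₁, ?_⟩
    cases s₁ <;> cases s₂
    · exact absurd rfl hab
    · exact fa.trans fb.symm
    · exact fb.trans fa.symm
    · exact absurd rfl hab
  refine ⟨fun x => decide (∃ e, φ.incVar e = x ∧
    (f (.adjacent e false) = f (.adjacent e true) ↔ φ.incSign e = true)), fun t => ?_⟩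
  obtain ⟨j, hj⟩ := hon t
  refine ⟨j, ?_⟩
  rw [Bool.eq_iff_iff, decide_eq_true_iff]
  constructor
  · rintro ⟨e, he, hs⟩
    exact ((R.paired_iff_sign hnear hpartner (e' := (t, j)) he).1 hs).1 hj
  · intro hs
    exact ⟨(t, j), rfl, iff_of_true hj hs⟩

theorem town_surjective (hγ0 : 0 < γ) (hγ : γ ≤ 1 / 3) (d : ℚ) :
    Function.Surjective (R.town d) := by
  intro τ
  have h := R.card_filter_town d {τ}
  have hpos := R.size_pos hγ0 hγ τ
  rw [Finset.sum_singleton] at h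
  rw [← h] at hpos
  obtain ⟨i, hi⟩ := Finset.card_pos.1 hpos
  rw [Finset.mem_filter] at hi
  exact ⟨i, by simpa using hi.2⟩

/-- The districts of a legal partition consist of whole towns. -/
theorem exists_districtMap (hγ0 : 0 < γ) (hγ : γ ≤ 1 / 3) {d : ℚ}
    {D : Fin (R.toInstance d).k → Finset (Fin (R.toInstance d).n)}
    (hD : (R.toInstance d).IsPartition D) (hF2 : (R.toInstance d).F2 D) :
    ∃ f : φ.Town R.len → Fin (R.toInstance d).k, ∀ l i, i ∈ D l ↔ f (R.town d i) = l := by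
  choose v hv using R.town_surjective hγ0 hγ d
  choose g hg using hD.2
  have key : ∀ l i, i ∈ D l → g (v (R.town d i)) = l := by
    intro l i hi
    by_contra hne
    have hmem : toPlane ((R.toInstance d).loc i) ∈
        (R.toInstance d).hull (D (g (v (R.town d i)))) ∩ (R.toInstance d).hull (D l) := by
      refine ⟨subset_convexHull ℝ _ ⟨v (R.town d i), hg _, ?_⟩, subset_convexHull ℝ _ ⟨i, hi, rfl⟩⟩
      simp only [toPlane_loc, hv]
    rw [hF2 _ _ hne] at hmem
    exact hmem
  refine ⟨fun τ => g (v τ), fun l i => ⟨key l i, ?_⟩⟩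
  rintro rfl
  have h := hg i
  rwa [← key _ i h] at h

theorem satisfiable_of_isSatisfiable {d : ℚ} (hγ0 : 0 < γ) (hγ : γ ≤ 1 / 3) (hd : 0 < d)
    (h : (R.toInstance d).IsSatisfiable γ d) : φ.Satisfiable := by
  obtain ⟨D, hD, ⟨hF1, hF2, hF3⟩, hF4⟩ := h
  obtain ⟨f, hf⟩ := R.exists_districtMap hγ0 hγ hD hF2
  have hDeq : ∀ l, D l = Finset.univ.filter fun i : Fin (R.toInstance d).n =>
      R.town d i ∈ Finset.univ.filter fun τ => f τ = l := by
    intro l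
    ext i
    rw [Finset.mem_filter, hf]
    simp
  refine R.satisfiable_of_districtMap (f := f) rfl ?_ ?_ ?_
  · intro τ σ h
    obtain ⟨i, rfl⟩ := R.town_surjective hγ0 hγ d τ
    obtain ⟨j, rfl⟩ := R.town_surjective hγ0 hγ d σ
    exact (R.norm_loc_sub_le_iff hd i j).1
      (hF3 _ i ((hf _ i).2 rfl) j ((hf _ j).2 h.symm))
  · intro t e s h
    have hk : 0 < (R.toInstance d).k := (Nat.zero_le _).trans_lt (f (.big t)).2
    have h₁ := (hF1 (f (.big t))).2
    have h₂ := R.upper_lt_size_big_add_adjacent hγ0 hγ d hk t e s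
    rw [hDeq, card_filter_town] at h₁
    have h₃ : R.size (.big t) + R.size (.adjacent e s) ≤
        ∑ τ with f τ = f (.big t), R.size τ := by
      rw [← Finset.sum_pair (f := R.size) (show Town.big t ≠ .adjacent e s by simp)]
      apply Finset.sum_le_sum_of_subset
      intro τ hτ
      rw [Finset.mem_insert, Finset.mem_singleton] at hτ
      rcases hτ with rfl | rfl <;> simp [h]
    have h₄ : (R.size (.big t) + R.size (.adjacent e s) : ℚ) ≤
        (∑ τ with f τ = f (.big t), R.size τ : ℕ) := by exact_mod_cast h₃
    linarith
  · refine le_trans hF4 (Finset.card_le_card fun l hl => ?_)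
    rw [Finset.mem_filter] at hl ⊢
    refine ⟨Finset.mem_univ _, ?_⟩
    have h := hl.2
    rw [hDeq, card_filter_town_pref, card_filter_town] at h
    have h' : ((∑ τ with f τ = l, R.size τ : ℕ) : ℚ) < 2 * (∑ τ with f τ = l, R.ones τ : ℕ) := by
      linarith
    exact_mod_cast h'

end Construction

end ThreeSAT

namespace ThreeSAT

namespace Construction

variable {φ : ThreeSAT} {γ : ℚ} (R : φ.Construction γ)

/-! ### Town sets that make good districts -/

/-- The town sets used as districts: a big clause town; two towns at distance at most `η` that are
not clause towns; a small clause town with the two clause-adjacent towns beside one of its edges. -/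
def IsBlock (S : Finset (φ.Town R.len)) : Prop :=
  (∃ t, S = {.big t}) ∨
  (∃ a b : φ.Town R.len, a.IsOther ∧ b.IsOther ∧ a ≠ b ∧ dist (R.place a) (R.place b) ≤ R.η ∧
    S = {a, b}) ∨
  ∃ e, S = {.small e.1, .adjacent e false, .adjacent e true}

variable {R}

theorem IsBlock.near {S : Finset (φ.Town R.len)} (hS : R.IsBlock S) {τ σ : φ.Town R.len}
    (hτ : τ ∈ S) (hσ : σ ∈ S) : R.Near τ σ := by
  have refl : ∀ τ, R.Near τ τ := fun τ =>
    R.near_of_dist_le (by rw [dist_self]; exact R.η_pos'.le)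
  rcases hS with ⟨t, rfl⟩ | ⟨a, b, -, -, -, h, rfl⟩ | ⟨e, rfl⟩
  · rw [Finset.mem_singleton] at hτ hσ
    rw [hτ, hσ]
    exact refl _
  · have hn := R.near_of_dist_le h
    simp only [Finset.mem_insert, Finset.mem_singleton] at hτ hσ
    rcases hτ with rfl | rfl <;> rcases hσ with rfl | rfl
    exacts [refl _, hn, hn.symm, refl _]
  · have h₁ : ∀ s, R.Near (.small e.1) (.adjacent e s) := R.dist_small_adjacent e
    have h₂ : ∀ s s', R.Near (.adjacent e s) (.adjacent e s') := fun s s' =>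
      R.near_of_dist_le ((R.dist_adjacent_same e s s').trans (by linarith [R.η_pos']))
    simp only [Finset.mem_insert, Finset.mem_singleton] at hτ hσ
    rcases hτ with rfl | rfl | rfl <;> rcases hσ with rfl | rfl | rfl
    exacts [refl _, h₁ _, h₁ _, (h₁ _).symm, h₂ _ _, h₂ _ _, (h₁ _).symm, h₂ _ _, h₂ _ _]

theorem size_isOther (hγ : γ ≤ 1 / 3) {τ : φ.Town R.len} (h : τ.IsOther) :
    R.L ≤ 2 * R.size τ ∧ 2 * R.size τ ≤ R.L + 2 * ⌊γ / 6 * (R.L : ℚ)⌋₊ := by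
  cases τ with
  | big => exact h.elim
  | small => exact h.elim
  | adjacent e s =>
    have := R.size_adjacent e s
    omega
  | edge e i =>
    have := R.size_edge hγ e i
    omega

theorem IsBlock.sum_size {S : Finset (φ.Town R.len)} (hS : R.IsBlock S) (hγ0 : 0 < γ)
    (hγ : γ ≤ 1 / 3) :
    (R.L : ℚ) ≤ (∑ τ ∈ S, R.size τ : ℕ) ∧ ((∑ τ ∈ S, R.size τ : ℕ) : ℚ) ≤ (1 + γ) * R.L := by
  have b₁ := R.floor_small_le hγ0
  have b₂ := R.floor_adjacent_le hγ0
  have hL := R.L_pos hγ0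
  have hγL := mul_pos hγ0 hL
  have key : R.L ≤ ∑ τ ∈ S, R.size τ ∧ ∑ τ ∈ S, R.size τ ≤
      R.L + 2 * ⌊γ / 6 * (R.L : ℚ)⌋₊ + ⌊2 * γ / 3 * (R.L : ℚ)⌋₊ := by
    rcases hS with ⟨t, rfl⟩ | ⟨a, b, ha, hb, hab, -, rfl⟩ | ⟨e, rfl⟩
    · rw [Finset.sum_singleton, size_big]
      omega
    · rw [Finset.sum_pair hab]
      have h₁ := size_isOther hγ ha
      have h₂ := size_isOther hγ hb
      omega
    · rw [Finset.sum_insert (by simp), Finset.sum_pair (by simp), size_small]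
      have h₁ := R.size_adjacent e false
      have h₂ := R.size_adjacent e true
      omega
  refine ⟨by exact_mod_cast key.1, ?_⟩
  have h : ((∑ τ ∈ S, R.size τ : ℕ) : ℚ) ≤
      R.L + 2 * (⌊γ / 6 * (R.L : ℚ)⌋₊ : ℚ) + (⌊2 * γ / 3 * (R.L : ℚ)⌋₊ : ℚ) := by
    exact_mod_cast key.2
  linarith

theorem IsBlock.eq_of_big_mem {S : Finset (φ.Town R.len)} (hS : R.IsBlock S)
    {t : Fin φ.numClauses} (ht : .big t ∈ S) : S = {.big t} := by
  rcases hS with ⟨t', rfl⟩ | ⟨a, b, ha, hb, -, -, rfl⟩ | ⟨e, rfl⟩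
  · rw [Finset.mem_singleton.1 ht]
  · simp only [Finset.mem_insert, Finset.mem_singleton] at ht
    rcases ht with rfl | rfl
    · exact ha.elim
    · exact hb.elim
  · simp at ht

theorem IsBlock.exists_eq_of_small_mem {S : Finset (φ.Town R.len)} (hS : R.IsBlock S)
    {t : Fin φ.numClauses} (ht : .small t ∈ S) :
    ∃ e, e.1 = t ∧ S = {.small e.1, .adjacent e false, .adjacent e true} := by
  rcases hS with ⟨t', rfl⟩ | ⟨a, b, ha, hb, -, -, rfl⟩ | ⟨e, rfl⟩
  · simp at ht
  · simp only [Finset.mem_insert, Finset.mem_singleton] at ht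
    rcases ht with rfl | rfl
    · exact ha.elim
    · exact hb.elim
  · simp only [Finset.mem_insert, Finset.mem_singleton, reduceCtorEq, or_false,
      Town.small.injEq] at ht
    exact ⟨e, ht.symm, rfl⟩

theorem IsBlock.majority_of_clause_town_mem {S : Finset (φ.Town R.len)} (hS : R.IsBlock S)
    (hγ0 : 0 < γ) (hγ : γ ≤ 1 / 3) {t : Fin φ.numClauses} (ht : .big t ∈ S ∨ .small t ∈ S) :
    ∑ τ ∈ S, R.size τ < 2 * ∑ τ ∈ S, R.ones τ := by
  have hL : 0 < R.L := by exact_mod_cast R.L_pos hγ0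
  rcases ht with ht | ht
  · rw [hS.eq_of_big_mem ht, Finset.sum_singleton, Finset.sum_singleton, size_big]
    simp only [ones]
    omega
  · obtain ⟨e, -, rfl⟩ := hS.exists_eq_of_small_mem ht
    rw [Finset.sum_insert (by simp), Finset.sum_pair (by simp), Finset.sum_insert (by simp),
      Finset.sum_pair (by simp)]
    have := R.two_mul_floor_adjacent_lt hγ0 hγ
    simp only [size, ones, zeros]
    omega

theorem coe_image_pair (a b : φ.Town R.len) :
    R.place '' (({a, b} : Finset (φ.Town R.len)) : Set (φ.Town R.len)) =
      {R.place a, R.place b} := by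
  rw [Finset.coe_pair, Set.image_pair]

theorem coe_image_triple (e : φ.Incidence) :
    R.place '' (({.small e.1, .adjacent e false, .adjacent e true} :
      Finset (φ.Town R.len)) : Set (φ.Town R.len)) = R.corners e := by
  simp [corners, Set.image_insert_eq]

theorem IsBlock.disjoint_hull {S S' : Finset (φ.Town R.len)} (hS : R.IsBlock S)
    (hS' : R.IsBlock S') (h : Disjoint S S') :
    Disjoint (convexHull ℝ (R.place '' S)) (convexHull ℝ (R.place '' S')) := by
  rcases hS with ⟨t, rfl⟩ | ⟨a, b, ha, hb, hab, dab, rfl⟩ | ⟨e, rfl⟩ <;>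
    rcases hS' with ⟨t', rfl⟩ | ⟨a', b', ha', hb', hab', dab', rfl⟩ | ⟨e', rfl⟩
  · have hne : t ≠ t' := by
      rintro rfl
      simp at h
    rw [Finset.coe_singleton, Finset.coe_singleton, Set.image_singleton, Set.image_singleton,
      convexHull_singleton, convexHull_singleton, Set.disjoint_singleton, place_big, place_big]
    intro h'
    have := R.dist_clausePos_lt hne
    rw [h', dist_self] at this
    linarith [R.η_pos']
  · rw [Finset.coe_singleton, Set.image_singleton, convexHull_singleton, coe_image_pair,
      convexHull_pair, Set.disjoint_singleton_left]
    exact R.big_notMem_segment ha' hb' dab' t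
  · rw [Finset.coe_singleton, Set.image_singleton, convexHull_singleton, coe_image_triple,
      Set.disjoint_singleton_left]
    exact R.big_notMem_corners e' t
  · rw [Finset.coe_singleton, Set.image_singleton, convexHull_singleton, coe_image_pair,
      convexHull_pair, Set.disjoint_singleton_right]
    exact R.big_notMem_segment ha hb dab t'
  · rw [coe_image_pair, coe_image_pair, convexHull_pair, convexHull_pair]
    simp only [Finset.disjoint_insert_left, Finset.disjoint_singleton_left, Finset.mem_insert,
      Finset.mem_singleton, not_or] at h
    exact R.disjoint_segment_segment ha hb ha' hb' hab hab' h.1.1 h.1.2 h.2.1 h.2.2 dab dab'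
  · rw [coe_image_pair, coe_image_triple, convexHull_pair]
    simp only [Finset.disjoint_insert_left, Finset.disjoint_singleton_left, Finset.mem_insert,
      Finset.mem_singleton, not_or] at h
    refine R.disjoint_segment_corners ha hb hab (fun s => ?_) (fun s => ?_) dab
    · cases s
      exacts [h.1.2.1, h.1.2.2]
    · cases s
      exacts [h.2.2.1, h.2.2.2]
  · rw [Finset.coe_singleton, Set.image_singleton, convexHull_singleton, coe_image_triple,
      Set.disjoint_singleton_right]
    exact R.big_notMem_corners e t'
  · rw [coe_image_pair, coe_image_triple, convexHull_pair]
    rw [disjoint_comm] at h ⊢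
    simp only [Finset.disjoint_insert_left, Finset.disjoint_singleton_left, Finset.mem_insert,
      Finset.mem_singleton, not_or] at h
    refine R.disjoint_segment_corners ha' hb' hab' (fun s => ?_) (fun s => ?_) dab'
    · cases s
      exacts [h.1.2.1, h.1.2.2]
    · cases s
      exacts [h.2.2.1, h.2.2.2]
  · rw [coe_image_triple, coe_image_triple]
    refine R.disjoint_corners_of_clause_ne fun he => ?_
    simp [he] at h

variable (R)

/-- A map of towns to districts whose fibres are blocks is a legal and fair redistricting. -/
theorem isSatisfiable_of_blocks {d : ℚ} (hγ0 : 0 < γ) (hγ : γ ≤ 1 / 3) (hd : 0 < d)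
    {f : φ.Town R.len → Fin (R.toInstance d).k}
    (hf : ∀ l, R.IsBlock (Finset.univ.filter fun τ => f τ = l)) :
    (R.toInstance d).IsSatisfiable γ d := by
  have hmem : ∀ l (i : Fin (R.toInstance d).n), i ∈ (Finset.univ.filter
      fun i : Fin (R.toInstance d).n => R.town d i ∈ Finset.univ.filter fun τ => f τ = l) ↔
      R.town d i ∈ Finset.univ.filter fun τ => f τ = l := fun l i => by
    rw [Finset.mem_filter]
    simp
  refine ⟨fun l => Finset.univ.filter fun i : Fin (R.toInstance d).n =>
    R.town d i ∈ Finset.univ.filter fun τ => f τ = l, ⟨?_, ?_⟩, ⟨?_, ?_, ?_⟩, ?_⟩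
  · intro l l' hne
    rw [Finset.disjoint_left]
    intro i hi hi'
    rw [hmem, Finset.mem_filter] at hi hi'
    exact hne (hi.2.symm.trans hi'.2)
  · intro i
    refine ⟨f (R.town d i), ?_⟩
    rw [hmem]
    simp
  · intro l
    have h := (hf l).sum_size hγ0 hγ
    have hk : 0 < (R.toInstance d).k := (Nat.zero_le _).trans_lt l.2
    rw [card_filter_town]
    exact R.size_bounds hγ0 hγ d hk h.1 h.2
  · intro l l' hne
    refine R.hull_inter_eq_empty hd (fun i hi => Finset.mem_coe.2 ((hmem l i).1 hi))
      (fun i hi => Finset.mem_coe.2 ((hmem l' i).1 hi)) ((hf l).disjoint_hull (hf l') ?_)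
    rw [Finset.disjoint_left]
    intro τ hτ hτ'
    rw [Finset.mem_filter] at hτ hτ'
    exact hne (hτ.2.symm.trans hτ'.2)
  · intro l i hi j hj
    exact (R.norm_loc_sub_le_iff hd i j).2 ((hf l).near ((hmem l i).1 hi) ((hmem l j).1 hj))
  · have hin : ∀ τ, τ ∈ Finset.univ.filter fun σ => f σ = f τ := by simp
    have hinj : Function.Injective
        (Sum.elim (fun t => f (.big t)) fun t => f (.small t)) := by
      have hbig : ∀ t τ, f τ = f (.big t) → τ = .big t := by
        intro t τ h
        have h₁ := (hf _).eq_of_big_mem (hin (.big t))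
        have h₂ : τ ∈ Finset.univ.filter fun σ => f σ = f (.big t) := by simpa using h
        rw [h₁] at h₂
        exact Finset.mem_singleton.1 h₂
      rintro (t | t) (t' | t') h
      · have := hbig _ _ h
        cases this
        rfl
      · have := hbig _ _ h.symm
        cases this
      · have := hbig _ _ h
        cases this
      · obtain ⟨e, he, h₁⟩ := (hf _).exists_eq_of_small_mem (hin (.small t'))
        have h₂ : .small t ∈ Finset.univ.filter fun σ => f σ = f (.small t') := by simpa using h
        rw [h₁, he] at h₂
        simp at h₂
        rw [h₂]
    have hcard : (R.toInstance d).m = (Finset.univ.image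
        (Sum.elim (fun t => f (.big t)) fun t => f (.small t))).card := by
      rw [Finset.card_image_of_injective _ hinj, Finset.card_univ, Fintype.card_sum,
        Fintype.card_fin, ← two_mul]
      rfl
    change (R.toInstance d).m ≤ _
    rw [hcard]
    refine Finset.card_le_card fun l hl => ?_
    rw [Finset.mem_filter]
    refine ⟨Finset.mem_univ _, ?_⟩
    rw [card_filter_town_pref, card_filter_town]
    have hmaj : ∑ τ with f τ = l, R.size τ < 2 * ∑ τ with f τ = l, R.ones τ := by
      rw [Finset.mem_image] at hl
      obtain ⟨t | t, -, rfl⟩ := hl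
      · exact (hf _).majority_of_clause_town_mem hγ0 hγ (Or.inl (hin _))
      · exact (hf _).majority_of_clause_town_mem hγ0 hγ (Or.inr (hin _))
    have : ((∑ τ with f τ = l, R.size τ : ℕ) : ℚ) < 2 * (∑ τ with f τ = l, R.ones τ : ℕ) := by
      exact_mod_cast hmaj
    linarith

/-! ### From an assignment to a redistricting -/

section Labels

/-- Labels of districts: `inl t` for the district of the big clause town of `t`; `inr ⟨e, p⟩` for a
district whose first town is at position `p` of the chain that starts beside `e`. -/
abbrev Label (φ : ThreeSAT) : Type := Fin φ.numClauses ⊕ ((_ : φ.Incidence) × ℕ)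

variable (on : φ.Incidence → Prop) [DecidablePred on] (sel : Fin φ.numClauses → Fin 3)

/-- The label of the district of a town, if the two towns beside an edge `e` form a pair exactly
when `on e` holds, and the small clause town of `t` joins the pair beside the edge `(t, sel t)`.
The other pairs consist of consecutive towns of a chain. -/
def label : φ.Town R.len → Label φ
  | .big t => .inl t
  | .small t => .inr ⟨(t, sel t), 0⟩
  | .adjacent e false => .inr ⟨e, 0⟩
  | .adjacent e true =>
    if on e then .inr ⟨e, 0⟩ else .inr ⟨R.next.symm e, R.len (R.next.symm e)⟩
  | .edge e i => if on e ↔ Odd (i + 1 : ℕ) then .inr ⟨e, i + 1⟩ else .inr ⟨e, i⟩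

/-- The labels in use. -/
def labels : Finset (Label φ) :=
  Finset.univ.disjSum (Finset.univ.sigma fun e =>
    (Finset.range (R.len e + 1)).filter fun p => p = 0 ∨ (on e ↔ Odd p))

/-- The town that is paired with the town at position `p` of the chain that starts beside `e`. -/
def partner (e : φ.Incidence) (p : ℕ) : φ.Town R.len :=
  if p = 0 ∧ on e then .adjacent e true else φ.chain R.len R.next e (p + 1)

/-- The towns with a given label. -/
def members : Label φ → Finset (φ.Town R.len)
  | .inl t => {.big t}
  | .inr ⟨e, p⟩ => {φ.chain R.len R.next e p, partner R on e p} ∪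
      if p = 0 ∧ sel e.1 = e.2 then {.small e.1} else ∅

theorem inr_mem_labels {e : φ.Incidence} {p : ℕ} :
    (.inr ⟨e, p⟩ : Label φ) ∈ R.labels on ↔ p ≤ R.len e ∧ (p = 0 ∨ (on e ↔ Odd p)) := by
  simp [labels]

theorem label_mem_labels
    (hon : ∀ e, on (R.next e) ↔ (on e ↔ Even (R.len e))) (τ : φ.Town R.len) :
    R.label on sel τ ∈ R.labels on := by
  cases τ with
  | big t => simp [label, labels]
  | small t => exact (R.inr_mem_labels on).2 ⟨Nat.zero_le _, Or.inl rfl⟩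
  | adjacent e s =>
    cases s
    · exact (R.inr_mem_labels on).2 ⟨Nat.zero_le _, Or.inl rfl⟩
    · simp only [label]
      split_ifs with h
      · exact (R.inr_mem_labels on).2 ⟨Nat.zero_le _, Or.inl rfl⟩
      · refine (R.inr_mem_labels on).2 ⟨le_rfl, Or.inr ?_⟩
        have h' := hon (R.next.symm e)
        rw [Equiv.apply_symm_apply] at h'
        rw [← Nat.not_even_iff_odd]
        tauto
  | edge e i =>
    have hi := i.2
    simp only [label]
    split_ifs with h
    · exact (R.inr_mem_labels on).2 ⟨hi, Or.inr h⟩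
    · refine (R.inr_mem_labels on).2 ⟨hi.le, Or.inr ?_⟩
      rw [Nat.odd_add_one] at h
      tauto

theorem mem_members_label (τ : φ.Town R.len) :
    τ ∈ R.members on sel (R.label on sel τ) := by
  cases τ with
  | big t => simp [label, members]
  | small t => simp [label, members]
  | adjacent e s =>
    cases s
    · simp [label, members, chain]
    · simp only [label]
      split_ifs with h
      · simp [members, partner, h]
      · have hl := R.len_pos (R.next.symm e)
        simp [members, partner, hl.ne', chain_succ_of_le]
  | edge e i =>
    simp only [label]
    split_ifs with h
    · simp [members, chain_succ_of_lt i.2]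
    · have hp : ¬ ((i : ℕ) = 0 ∧ on e) := by
        rintro ⟨h₀, h₁⟩
        simp [h₀, h₁] at h
      simp only [members, partner, if_neg hp, chain_succ_of_lt i.2]
      simp

theorem label_eq_of_mem_members
    (hon : ∀ e, on (R.next e) ↔ (on e ↔ Even (R.len e))) {x : Label φ} (hx : x ∈ R.labels on)
    {τ : φ.Town R.len} (hτ : τ ∈ R.members on sel x) : R.label on sel τ = x := by
  rcases x with t | ⟨e, p⟩
  · rw [members, Finset.mem_singleton] at hτ
    rw [hτ, label]
  obtain ⟨hp, hh⟩ := (R.inr_mem_labels on).1 hx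
  simp only [members, Finset.mem_union, Finset.mem_insert, Finset.mem_singleton] at hτ
  rcases hτ with (rfl | rfl) | hτ
  · rcases p with _ | i
    · rfl
    · rw [chain_succ_of_lt (by omega), label, if_pos (by simpa using hh)]
  · by_cases h₀ : p = 0 ∧ on e
    · rw [partner, if_pos h₀, label, if_pos h₀.2, h₀.1]
    · have hh' : on e ↔ Odd p := by
        rcases hh with rfl | hh
        · simpa using h₀
        · exact hh
      rw [partner, if_neg h₀]
      by_cases hl : p < R.len e
      · rw [chain_succ_of_lt hl, label, if_neg]
        rw [Nat.odd_add_one]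
        tauto
      · obtain rfl : p = R.len e := by omega
        rw [chain_succ_of_le le_rfl, label, if_neg, Equiv.symm_apply_apply]
        rw [hon, ← Nat.not_odd_iff_even]
        tauto
  · split_ifs at hτ with h
    · rw [Finset.mem_singleton] at hτ
      rw [hτ, label, h.1, h.2]
    · simp at hτ

theorem isBlock_members (hsel : ∀ t, on (t, sel t)) {x : Label φ} (hx : x ∈ R.labels on) :
    R.IsBlock (R.members on sel x) := by
  rcases x with t | ⟨e, p⟩
  · exact Or.inl ⟨t, rfl⟩
  obtain ⟨hp, -⟩ := (R.inr_mem_labels on).1 hx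
  simp only [members]
  split_ifs with h
  · obtain ⟨rfl, h⟩ := h
    have he : on e := by
      have := hsel e.1
      rwa [h] at this
    refine Or.inr (Or.inr ⟨e, ?_⟩)
    rw [partner, if_pos ⟨rfl, he⟩, chain]
    ext τ
    simp only [Finset.mem_union, Finset.mem_insert, Finset.mem_singleton]
    tauto
  · rw [Finset.union_empty]
    refine Or.inr (Or.inl ⟨_, _, isOther_chain _ _, ?_, ?_, ?_, rfl⟩)
    · rw [partner]
      split_ifs
      · trivial
      · exact isOther_chain _ _
    · rw [partner]
      split_ifs with h₀
      · rw [h₀.1, chain]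
        simp
      · intro h'
        have := chain_injOn (by omega) (by omega) h'
        omega
    · rw [partner]
      split_ifs with h₀
      · rw [h₀.1, chain]
        exact (R.dist_adjacent_same e _ _).trans (by linarith [R.η_pos'])
      · exact R.dist_chain_le e hp

/-- In a chain with `l` edge towns, the number of positions at which a pair starts is
`(l + 2) / 2`, corrected by the difference between the states (`b` and `b ↔ Even l`) of the edges at
its two ends. These corrections cancel around every variable. -/
theorem two_mul_card_heads (b : Prop) [Decidable b] (l : ℕ) :
    2 * ((Finset.range (l + 1)).filter fun p => p = 0 ∨ (b ↔ Odd p)).card +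
      (if b ↔ Even l then 1 else 0) = l + 2 + if b then 1 else 0 := by
  induction l with
  | zero => simp [Finset.filter_singleton]
  | succ l ih =>
    rw [Finset.range_add_one, Finset.filter_insert]
    by_cases hb : b <;> by_cases hl : Even l <;>
      simp [hb, hl, Nat.even_add_one, ← Nat.not_even_iff_odd] at ih ⊢ <;> omega

theorem card_labels (hon : ∀ e, on (R.next e) ↔ (on e ↔ Even (R.len e))) :
    (R.labels on).card = φ.numClauses + R.numOther / 2 := by
  have h₁ : 2 * ∑ e, ((Finset.range (R.len e + 1)).filter
        fun p => p = 0 ∨ (on e ↔ Odd p)).card + ∑ e, (if on (R.next e) then 1 else 0) =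
      (∑ e, R.len e + 2 * (φ.numClauses * 3)) + ∑ e, if on e then 1 else 0 := by
    have hc : 2 * (φ.numClauses * 3) = ∑ _e : φ.Incidence, 2 := by simp; ring
    rw [hc, Finset.mul_sum, ← Finset.sum_add_distrib, ← Finset.sum_add_distrib,
      ← Finset.sum_add_distrib]
    refine Finset.sum_congr rfl fun e _ => ?_
    rw [← two_mul_card_heads (on e) (R.len e)]
    simp only [hon]
  rw [Equiv.sum_comp R.next fun e => if on e then 1 else 0] at h₁
  rw [labels, Finset.card_disjSum, Finset.card_sigma, Finset.card_univ, Fintype.card_fin, numOther]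
  omega

end Labels

theorem isSatisfiable_of_satisfiable {d : ℚ} (hγ0 : 0 < γ) (hγ : γ ≤ 1 / 3) (hd : 0 < d)
    (h : φ.Satisfiable) : (R.toInstance d).IsSatisfiable γ d := by
  obtain ⟨a, ha⟩ := h
  choose sel hsel using ha
  -- The towns beside an edge are paired where the assignment makes the literal true.
  let on : φ.Incidence → Prop := fun e => a (φ.incVar e) = φ.incSign e
  have hon : ∀ e, on (R.next e) ↔ (on e ↔ Even (R.len e)) := by
    intro e
    have hv : φ.incVar e = φ.incVar (R.next e) :=
      (R.next_spec e (R.next e)).1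
        (Equiv.Perm.sameCycle_apply_right.2 (Equiv.Perm.SameCycle.refl _ _))
    simp only [on, ← hv, R.len_parity e]
    cases a (φ.incVar e) <;> cases φ.incSign e <;> cases φ.incSign (R.next e) <;> simp
  have hsel' : ∀ t, on (t, sel t) := hsel
  let E : {x // x ∈ R.labels on} ≃ Fin (R.toInstance d).k :=
    Fintype.equivFinOfCardEq (by rw [Fintype.card_coe, R.card_labels on hon]; rfl)
  refine R.isSatisfiable_of_blocks hγ0 hγ hd
    (f := fun τ => E ⟨R.label on sel τ, R.label_mem_labels on sel hon τ⟩) fun l => ?_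
  have heq : (Finset.univ.filter fun τ =>
      E ⟨R.label on sel τ, R.label_mem_labels on sel hon τ⟩ = l) =
      R.members on sel (E.symm l).1 := by
    ext τ
    rw [Finset.mem_filter, ← Equiv.eq_symm_apply, Subtype.ext_iff]
    constructor
    · rintro ⟨-, h⟩
      rw [← h]
      exact R.mem_members_label on sel τ
    · exact fun h => ⟨Finset.mem_univ _, R.label_eq_of_mem_members on sel hon (E.symm l).2 h⟩
  rw [heq]
  exact R.isBlock_members on sel hsel' (E.symm l).2

end Construction

end ThreeSAT

theorem mainTheorem2 (φ : ThreeSAT) (hφ : φ.IsPlanar) (γ d : ℚ) (hγ0 : 0 < γ)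
    (hγ : γ ≤ 1 / 3) (hd : 0 < d) (R : φ.Construction γ) :
    (R.toInstance d).IsSatisfiable γ d ↔ φ.Satisfiable :=
  ⟨R.satisfiable_of_isSatisfiable hγ0 hγ hd, R.isSatisfiable_of_satisfiable hγ0 hγ hd⟩
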